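/- Let $K$ be an algebraically closed field that is complete with respect to a non-Archimedean absolute value, with ring of integers $\mathcal O$ and residue field $k$. Put $q_v=e$ if $\mathrm{char}(k)=0$ and $q_v=\mathrm{char}(k)$ otherwise, and $\mathrm{ord}(x)=-\log_{q_v}|x|$. A lift of a rational function $\psi\in K(z)$ of degree $D$ is a pair $[F,G]$ of coprime binary forms of degree $D$ over $K$ with $\psi(z)=F(z,1)/G(z,1)$; it is normalized if the maximum of the absolute values of its $2D+2$ coefficients is $1$. Let $R_\psi=\mathrm{ord}(\mathrm{Res}(F,G))$ for any normalized lift $[F,G]$ of $\psi$, and let $R_{[\psi]}=\min_{\gamma\in \mathrm{PGL}_2(K)}R_{\psi^\gamma}$, where $\psi^\gamma=\gamma^{-1}\circ\psi\circ\gamma$. Let $A_D$ be the polynomial ring over $\mathbb Z$ in the $2D+2$ coefficients $(a,b)$ of a pair of binary forms of degree $D$, on which $\mathrm{SL}_2$ acts by conjugation of pairs of forms. A point of $\mathbb P^{2D+1}(k)$ is semistable if some homogeneous element of positive degree of the invariant ring $A_D^{\mathrm{SL}_2}$ does not vanish at it. We say that $\psi$ has semistable reduction if the coefficients of a normalized lift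 of $\psi$, reduced modulo the maximal ideal of $\mathcal O$, give a semistable point of $\mathbb P^{2D+1}(k)$. Let $\varphi\in K(z)$ have degree $d\ge 2$, and put $N_m=\dfrac{d^m(d^m-1)}{d(d-1)}$ for $m\ge 0$. Suppose that for some $n\ge 1$ the iterate $\varphi^n$ has semistable reduction and $R_{\varphi^n}=N_n\cdot R_\varphi$. Then: (1) $\varphi$ itself has semistable reduction, the minima defining $R_{[\varphi]}$ and $R_{[\varphi^n]}$ are attained, and the minimal resultant iteration formula $R_{[\varphi^n]}=N_n\cdot R_{[\varphi]}$ holds for this $n$. (2) If $n\ge 2$, then $R_{\varphi^m}=N_m\cdot R_\varphi$ for every $m\ge 0$. -/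

import Mathlib

noncomputable section

namespace RatDyn

universe u

/-! ### Pairs of binary forms of degree `d` -/

/-- The `2d+2` coefficients of a pair of binary forms of degree `d` over `R`:
`a (0, j)` and `a (1, j)` are the coefficients of `X^j Y^(d-j)` in `F` and `G`. -/
abbrev Coeffs (d : ℕ) (R : Type*) := Fin 2 × Fin (d + 1) → R

/-- The dehomogenized form: `F(z,1)` for `i = 0`, and `G(z,1)` for `i = 1`. -/
def coordPoly {d : ℕ} {R : Type*} [CommRing R] (a : Coeffs d R) (i : Fin 2) : Polynomial R :=
  ∑ j : Fin (d + 1), Polynomial.C (a (i, j)) * Polynomial.X ^ (j : ℕ)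

/-- The resultant form `ρ_d`: the resultant `Res(F, G)` of two binary forms of degree `d`
(the determinant of their `2d × 2d` Sylvester matrix). -/
def resForm {d : ℕ} {R : Type*} [CommRing R] (a : Coeffs d R) : R :=
  Polynomial.resultant (coordPoly a 0) (coordPoly a 1) d d

/-- The action of `SL₂` by conjugation on pairs of forms `Φ = (F, G)`: the coefficients of
`g⁻¹ ∘ Φ ∘ g`. Forms are written dehomogenized (`X = z`, `Y = 1`), so `F(g (X, Y))` is
`∑ a_j (αz+β)^j (γz+δ)^(d-j)`. -/
def conjCoeffs {d : ℕ} {R : Type*} [CommRing R]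
    (g : Matrix.SpecialLinearGroup (Fin 2) R) (a : Coeffs d R) : Coeffs d R :=
  let L : Fin 2 → Polynomial R := fun i =>
    Polynomial.C (g.1 i 0) * Polynomial.X + Polynomial.C (g.1 i 1)
  let P : Fin 2 → Polynomial R := fun i =>
    ∑ j : Fin (d + 1), Polynomial.C (a (i, j)) * L 0 ^ (j : ℕ) * L 1 ^ (d - (j : ℕ))
  fun ij => (∑ l : Fin 2, Polynomial.C (g⁻¹.1 ij.1 l) * P l).coeff (ij.2 : ℕ)

/-! ### Semistable points -/

/-- `H ∈ A_d = ℤ[a, b]` is invariant under the group scheme `SL₂` over `ℤ`: it is invariant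
under `SL₂(R)` on `R`-valued coefficients, for every commutative ring `R`. (The condition does
not depend on the universe `u`: the universal case is the countable ring
`ℤ[a, b][α, β, γ, δ]/(αδ - βγ - 1)`.) -/
def IsSL2Invariant {d : ℕ} (H : MvPolynomial (Fin 2 × Fin (d + 1)) ℤ) : Prop :=
  ∀ (R : Type u) [CommRing R] (g : Matrix.SpecialLinearGroup (Fin 2) R) (a : Coeffs d R),
    MvPolynomial.aeval (conjCoeffs g a) H = MvPolynomial.aeval a H

/-- A point of `ℙ^{2d+1}(k)` is semistable if it lies outside the indeterminacy locus of the
rational map `Proj A_d ⇢ Proj A_d^{SL₂}`, that is, if some homogeneous `SL₂`-invariant form of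
positive degree does not vanish at it. -/
def IsSemistable {d : ℕ} {k : Type u} [Field k] (a : Coeffs d k) : Prop :=
  ∃ (D : ℕ) (H : MvPolynomial (Fin 2 × Fin (d + 1)) ℤ), 0 < D ∧ H.IsHomogeneous D ∧
    IsSL2Invariant.{u} H ∧ MvPolynomial.aeval a H ≠ 0

/-! ### Rational functions: composition, iterates, conjugates, degree, lifts -/

section Field

variable {K : Type*} [Field K]

/-- The composition `φ ∘ ψ` (used only for non-constant `ψ`). -/
def comp (φ ψ : RatFunc K) : RatFunc K := RatFunc.eval RatFunc.C ψ φ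

/-- The `n`-th iterate `φ^n = φ ∘ ⋯ ∘ φ`. -/
def iter (φ : RatFunc K) : ℕ → RatFunc K
  | 0 => RatFunc.X
  | n + 1 => comp φ (iter φ n)

/-- The Möbius transformation `z ↦ (αz+β)/(γz+δ)` given by a matrix. -/
def mobius (γ : Matrix.GeneralLinearGroup (Fin 2) K) : RatFunc K :=
  (RatFunc.C (γ.1 0 0) * RatFunc.X + RatFunc.C (γ.1 0 1)) /
    (RatFunc.C (γ.1 1 0) * RatFunc.X + RatFunc.C (γ.1 1 1))

/-- The conjugate `φ^γ = γ⁻¹ ∘ φ ∘ γ`. -/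
def conj (φ : RatFunc K) (γ : Matrix.GeneralLinearGroup (Fin 2) K) : RatFunc K :=
  comp (mobius γ⁻¹) (comp φ (mobius γ))

/-- The degree of a rational function. -/
def degree (φ : RatFunc K) : ℕ := max φ.num.natDegree φ.denom.natDegree

/-- `a` is the coefficient vector of a homogeneous lift `[F, G]` of `φ`: the forms `F, G` are
coprime (nonzero resultant) and `φ(z) = F(z,1)/G(z,1)`. Then `d` is the degree of `φ`, see
`IsLift.eq_smul` below. -/
def IsLift {d : ℕ} (φ : RatFunc K) (a : Coeffs d K) : Prop :=
  resForm a ≠ 0 ∧ coordPoly a 1 ≠ 0 ∧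
    φ = algebraMap (Polynomial K) (RatFunc K) (coordPoly a 0) /
      algebraMap (Polynomial K) (RatFunc K) (coordPoly a 1)

end Field

/-! ### Normalized lifts and the resultant over a non-Archimedean field -/

section NonArch

variable {K : Type u} [NormedField K] [IsUltrametricDist K]

/-- The ring of integers `{x : |x| ≤ 1}`. -/
abbrev Integers (K : Type u) [NormedField K] [IsUltrametricDist K] : ValuationSubring K :=
  (NormedField.valuation (K := K)).valuationSubring

/-- The residue field `k`. -/
abbrev Residue (K : Type u) [NormedField K] [IsUltrametricDist K] : Type u :=
  IsLocalRing.ResidueField (Integers K)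

/-- The base `q_v`: `e` if `char k = 0`, and `char k` otherwise. -/
def logBase (K : Type u) [NormedField K] [IsUltrametricDist K] : ℝ :=
  if ringChar (Residue K) = 0 then Real.exp 1 else (ringChar (Residue K) : ℝ)

/-- `ord x = -log_{q_v} |x|` (for `x ≠ 0`). -/
def ord (x : K) : ℝ := -Real.logb (logBase K) ‖x‖

/-- A normalized lift of `φ`: a lift whose coefficients lie in the ring of integers, at least
one of them having absolute value `1`. -/
def IsNormalizedLift {d : ℕ} (φ : RatFunc K) (a : Coeffs d (Integers K)) : Prop :=
  IsLift φ (fun ij => (a ij : K)) ∧ ∃ ij, ‖(a ij : K)‖ = 1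

/-- The coefficients reduced modulo the maximal ideal. -/
def reduce {d : ℕ} (a : Coeffs d (Integers K)) : Coeffs d (Residue K) :=
  fun ij => IsLocalRing.residue (Integers K) (a ij)

/-- `φ` has semistable reduction: the reduction `φ_v` of `φ`, a point of `ℙ^{2d+1}(k)`, is
semistable. -/
def HasSemistableReduction (φ : RatFunc K) : Prop :=
  ∃ (d : ℕ) (a : Coeffs d (Integers K)), IsNormalizedLift φ a ∧ IsSemistable (reduce a)

end NonArch

/-! ### Every rational function has a normalized lift, and it is unique up to scaling -/

section Lifts

lemma coeff_coordPoly {d : ℕ} {R : Type*} [CommRing R] (a : Coeffs d R) (i : Fin 2)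
    (j : Fin (d + 1)) : (coordPoly a i).coeff (j : ℕ) = a (i, j) := by
  simp only [coordPoly, Polynomial.finsetSum_coeff, Polynomial.coeff_C_mul,
    Polynomial.coeff_X_pow]
  rw [Finset.sum_eq_single j]
  · simp
  · intro b _ hb
    have : (j : ℕ) ≠ b := fun h => hb (Fin.ext h.symm)
    simp [this]
  · simp

lemma natDegree_coordPoly_le {d : ℕ} {R : Type*} [CommRing R] (a : Coeffs d R) (i : Fin 2) :
    (coordPoly a i).natDegree ≤ d := by
  refine Polynomial.natDegree_sum_le_of_forall_le _ _ fun j _ => ?_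
  exact (Polynomial.natDegree_C_mul_X_pow_le _ _).trans (by omega)

lemma coordPoly_of_coeff {d : ℕ} {R : Type*} [CommRing R] (p : Fin 2 → Polynomial R)
    (i : Fin 2) (h : (p i).natDegree ≤ d) :
    coordPoly (d := d) (fun ij => (p ij.1).coeff (ij.2 : ℕ)) i = p i := by
  conv_rhs => rw [(p i).as_sum_range_C_mul_X_pow' (Nat.lt_succ_of_le h)]
  rw [Finset.sum_range]
  rfl

variable {K : Type u}

/-- A lift of `φ` has the degree of `φ`, and is a multiple of `[num φ, denom φ]`. -/
lemma IsLift.eq_smul [Field K] {d : ℕ} {φ : RatFunc K} {a : Coeffs d K} (h : IsLift φ a) :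
    d = degree φ ∧ ∃ c : K, c ≠ 0 ∧ coordPoly a 0 = Polynomial.C c * φ.num ∧
      coordPoly a 1 = Polynomial.C c * φ.denom := by
  obtain ⟨hr, hG, hφ⟩ := h
  set F := coordPoly a 0 with hF'
  set G := coordPoly a 1 with hG'
  have hFd : F.natDegree ≤ d := natDegree_coordPoly_le a 0
  have hGd : G.natDegree ≤ d := natDegree_coordPoly_le a 1
  have hcop : IsCoprime F G := by
    rcases Nat.eq_zero_or_pos d with hd | hd
    · have hu : IsUnit G := by
        rw [Polynomial.isUnit_iff_degree_eq_zero, Polynomial.degree_eq_natDegree hG]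
        have : G.natDegree = 0 := by omega
        simp [this]
      obtain ⟨v, hv⟩ := hu.exists_left_inv
      exact ⟨0, v, by simp [hv]⟩
    · obtain ⟨p, q, -, -, e⟩ := Polynomial.exists_mul_add_mul_eq_C_resultant F G hFd hGd
        (Or.inl hd.ne')
      refine ⟨Polynomial.C (resForm a)⁻¹ * p, Polynomial.C (resForm a)⁻¹ * q, ?_⟩
      have e2 : F * p + G * q = Polynomial.C (resForm a) := e
      have e3 : Polynomial.C (resForm a)⁻¹ * Polynomial.C (resForm a) = (1 : Polynomial K) := by
        rw [← Polynomial.C_mul, inv_mul_cancel₀ hr, Polynomial.C_1]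
      linear_combination Polynomial.C (resForm a)⁻¹ * e2 + e3
  have hGne : algebraMap (Polynomial K) (RatFunc K) G ≠ 0 := by
    simpa using hG
  have hdne : algebraMap (Polynomial K) (RatFunc K) φ.denom ≠ 0 := by
    simpa using φ.denom_ne_zero
  have hcross : φ.num * G = F * φ.denom := by
    apply RatFunc.algebraMap_injective K
    rw [map_mul, map_mul]
    have := φ.num_div_denom
    rw [hφ] at this
    rw [← hφ] at this
    rw [← div_eq_div_iff hdne hGne, this]
    exact hφ
  have hd1 : φ.denom ∣ G := by
    refine (φ.isCoprime_num_denom.symm).dvd_of_dvd_mul_left ?_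
    exact ⟨F, by rw [hcross]; ring⟩
  have hd2 : G ∣ φ.denom := by
    refine (hcop.symm).dvd_of_dvd_mul_left ?_
    exact ⟨φ.num, by rw [← hcross]; ring⟩
  obtain ⟨w, hw⟩ := associated_of_dvd_dvd hd1 hd2
  obtain ⟨c, hc, hcw⟩ := Polynomial.isUnit_iff.1 w.isUnit
  have hG2 : G = Polynomial.C c * φ.denom := by rw [← hw, ← hcw]; ring
  have hF2 : F = Polynomial.C c * φ.num := by
    apply mul_right_cancel₀ φ.denom_ne_zero
    rw [← hcross, hG2]; ring
  have hc0 : c ≠ 0 := hc.ne_zero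
  refine ⟨?_, c, hc0, hF2, hG2⟩
  have e1 : F.natDegree = φ.num.natDegree := by
    rw [hF2, Polynomial.natDegree_C_mul hc0]
  have e2 : G.natDegree = φ.denom.natDegree := by
    rw [hG2, Polynomial.natDegree_C_mul hc0]
  have : ¬ (F.natDegree < d ∧ G.natDegree < d) := fun hlt =>
    hr (Polynomial.resultant_eq_zero_of_lt_lt _ _ _ _ hlt.1 hlt.2)
  unfold degree
  omega

lemma exists_isNormalizedLift [NormedField K] [IsUltrametricDist K] (φ : RatFunc K) :
    ∃ a : Coeffs (degree φ) (Integers K), IsNormalizedLift φ a := by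
  classical
  set p : Fin 2 → Polynomial K := ![φ.num, φ.denom] with hp
  let b : Coeffs (degree φ) K := fun ij => (p ij.1).coeff (ij.2 : ℕ)
  have hb0 : coordPoly b 0 = φ.num := coordPoly_of_coeff p 0 (le_max_left _ _)
  have hb1 : coordPoly b 1 = φ.denom := coordPoly_of_coeff p 1 (le_max_right _ _)
  obtain ⟨m, hm⟩ := Finite.exists_max (fun ij => ‖b ij‖)
  have hm0 : b m ≠ 0 := by
    intro h0
    apply φ.denom_ne_zero
    rw [← hb1]
    have : ∀ ij, b ij = 0 := fun ij => by
      have := hm ij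
      rw [h0, norm_zero] at this
      exact norm_le_zero_iff.1 this
    simp [coordPoly, this]
  have hle : ∀ ij, ‖b ij / b m‖ ≤ 1 := fun ij => by
    rw [norm_div]
    exact div_le_one_of_le₀ (hm ij) (norm_nonneg _)
  refine ⟨fun ij => ⟨b ij / b m, ?_⟩, ⟨?_, ?_, ?_⟩, m, ?_⟩
  · rw [Valuation.mem_valuationSubring_iff]
    exact_mod_cast hle ij
  · have hs : ∀ i, coordPoly (fun ij => b ij / b m) i =
        Polynomial.C (b m)⁻¹ * coordPoly b i := fun i => by
      simp only [coordPoly, Finset.mul_sum, div_eq_mul_inv, Polynomial.C_mul]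
      exact Finset.sum_congr rfl fun j _ => by ring
    change Polynomial.resultant (coordPoly (fun ij => b ij / b m) 0)
      (coordPoly (fun ij => b ij / b m) 1) _ _ ≠ 0
    rw [hs, hs, Polynomial.resultant_C_mul_left, Polynomial.resultant_C_mul_right, hb0, hb1]
    refine mul_ne_zero (pow_ne_zero _ (inv_ne_zero hm0))
      (mul_ne_zero (pow_ne_zero _ (inv_ne_zero hm0)) ?_)
    have key := Polynomial.resultant_ne_zero _ _ φ.isCoprime_num_denom
    rcases le_total φ.num.natDegree φ.denom.natDegree with h | h
    · obtain ⟨t, ht⟩ := Nat.exists_eq_add_of_le h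
      have hdeg : degree φ = φ.denom.natDegree := max_eq_right h
      have := Polynomial.resultant_add_left_deg φ.num φ.denom φ.num.natDegree
        φ.denom.natDegree t le_rfl
      rw [hdeg]
      rw [← ht] at this
      rw [this]
      refine mul_ne_zero (mul_ne_zero ?_ ?_) key
      · exact pow_ne_zero _ (by simp)
      · exact pow_ne_zero _ (by simpa using φ.denom_ne_zero)
    · obtain ⟨t, ht⟩ := Nat.exists_eq_add_of_le h
      have hdeg : degree φ = φ.num.natDegree := max_eq_left h
      rcases eq_or_ne φ.num 0 with h0 | h0
      · have h1 : φ.denom.natDegree = 0 := by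
          have : φ.num.natDegree = 0 := by simp [h0]
          omega
        have : degree φ = 0 := by rw [hdeg]; simp [h0]
        rw [this]
        simp
      have := Polynomial.resultant_add_right_deg φ.num φ.denom φ.num.natDegree
        φ.denom.natDegree t le_rfl
      rw [hdeg]
      rw [← ht] at this
      rw [this]
      refine mul_ne_zero ?_ key
      exact pow_ne_zero _ (by simpa using h0)
  · intro h
    have h2 := congrArg (fun q => Polynomial.C (b m) * q) h
    have hs : Polynomial.C (b m) * coordPoly (fun ij => b ij / b m) 1 = coordPoly b 1 := by
      simp only [coordPoly, Finset.mul_sum, ← mul_assoc, ← Polynomial.C_mul,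
        mul_div_cancel₀ _ hm0]
    apply φ.denom_ne_zero
    rw [← hb1, ← hs]
    simpa using h2
  · have hs : ∀ i, coordPoly (fun ij => b ij / b m) i =
        Polynomial.C (b m)⁻¹ * coordPoly b i := fun i => by
      simp only [coordPoly, Finset.mul_sum, div_eq_mul_inv, Polynomial.C_mul]
      exact Finset.sum_congr rfl fun j _ => by ring
    change φ = algebraMap _ _ (coordPoly (fun ij => b ij / b m) 0) /
      algebraMap _ _ (coordPoly (fun ij => b ij / b m) 1)
    rw [hs, hs, hb0, hb1, map_mul, map_mul, mul_div_mul_left, φ.num_div_denom]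
    simpa using hm0
  · change ‖b m / b m‖ = 1
    rw [div_self hm0, norm_one]

end Lifts

/-! ### The resultant of a rational map -/

section Resultant

variable {K : Type u} [NormedField K] [IsUltrametricDist K]

/-- `R_φ`: the `ord` value of the resultant of a normalized lift of `φ`. It does not depend on
the normalized lift, see `ordRes_eq` below. -/
def ordRes (φ : RatFunc K) : ℝ :=
  ord (resForm (fun ij => ((exists_isNormalizedLift φ).choose ij : K)))

lemma ordRes_eq {d : ℕ} {φ : RatFunc K} {a : Coeffs d (Integers K)}
    (h : IsNormalizedLift φ a) : ordRes φ = ord (resForm (fun ij => (a ij : K))) := by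
  obtain ⟨hd, -⟩ := h.1.eq_smul
  subst hd
  obtain ⟨-, c, hc, hF, hG⟩ := h.1.eq_smul
  have h' := (exists_isNormalizedLift φ).choose_spec
  obtain ⟨-, c', hc', hF', hG'⟩ := h'.1.eq_smul
  set b := (exists_isNormalizedLift φ).choose
  have hco : ∀ ij, (a ij : K) = c * (![φ.num, φ.denom] ij.1).coeff (ij.2 : ℕ) := by
    rintro ⟨i, j⟩
    rw [← coeff_coordPoly (fun ij => (a ij : K)) i j]
    fin_cases i
    · simp [hF]
    · simp [hG]
  have hco' : ∀ ij, (b ij : K) = c' * (![φ.num, φ.denom] ij.1).coeff (ij.2 : ℕ) := by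
    rintro ⟨i, j⟩
    rw [← coeff_coordPoly (fun ij => (b ij : K)) i j]
    fin_cases i
    · simp [hF']
    · simp [hG']
  have hle : ∀ x : Integers K, ‖(x : K)‖ ≤ 1 := fun x => by
    have := (Valuation.mem_valuationSubring_iff _ _).1 x.2
    exact_mod_cast this
  have hcc : ‖c‖ = ‖c'‖ := by
    obtain ⟨s, hs⟩ := h.2
    obtain ⟨t, ht⟩ := h'.2
    have hs' := hle (b s)
    have ht' := hle (a t)
    rw [hco, norm_mul] at hs ht'
    rw [hco', norm_mul] at ht hs'
    have p1 : 0 < ‖c‖ := norm_pos_iff.2 hc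
    have p2 : 0 < ‖c'‖ := norm_pos_iff.2 hc'
    set x := ‖(![φ.num, φ.denom] s.1).coeff (s.2 : ℕ)‖
    set y := ‖(![φ.num, φ.denom] t.1).coeff (t.2 : ℕ)‖
    have hx : 0 < x := by
      by_contra hx
      have := mul_nonpos_of_nonneg_of_nonpos p1.le (not_lt.1 hx)
      linarith
    have hy : 0 < y := by
      by_contra hy
      have := mul_nonpos_of_nonneg_of_nonpos p2.le (not_lt.1 hy)
      linarith
    apply le_antisymm
    · exact le_of_mul_le_mul_right (ht'.trans ht.ge) hy
    · exact le_of_mul_le_mul_right (hs'.trans hs.ge) hx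
  unfold ordRes ord
  congr 2
  unfold resForm
  rw [hF, hG, hF', hG']
  simp only [Polynomial.resultant_C_mul_left, Polynomial.resultant_C_mul_right, norm_mul,
    norm_pow, hcc]

/-- `r` is the minimal resultant `R_[φ]`: the minimum of `R_{φ^γ}` over all conjugates of `φ`
by elements `γ` of `PGL₂(K)` (given by matrices in `GL₂(K)`). -/
def IsMinimalResultant (φ : RatFunc K) (r : ℝ) : Prop :=
  IsLeast (Set.range fun γ : Matrix.GeneralLinearGroup (Fin 2) K => ordRes (conj φ γ)) r

/-- The number `N = d^n (d^n - 1) / (d (d - 1))`. -/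
def iterExponent (d n : ℕ) : ℝ :=
  ((d : ℝ) ^ n * ((d : ℝ) ^ n - 1)) / ((d : ℝ) * ((d : ℝ) - 1))

end Resultant

end RatDyn

end

noncomputable section

namespace RatDyn

universe u

open Polynomial

/-! ### Evaluation of binary forms -/

section FormEval

variable {R S : Type*} [CommRing R] [CommRing S] [Algebra R S]

/-! Fix a normalized lift Φ of φ. Resultants of compositions satisfy Res(P ∘ Q) = Res(P)^e ·
Res(Q)^(d²) for pairs P, Q of degrees d, e (`resultant_compPair`), so the iterated lift Φ^n has ord
Res(Φ^n) = N_n · R_φ. Its coefficients are integral. If c is the largest of them, dividing by c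
gives R_{φ^n} = N_n · R_φ - 2 d^n ord(c). Thus the formula at n says exactly that Φ^n is already
normalized (`ordRes_iter_eq_iff`), or equivalently that the n-th iterate of the reduced pair does
not vanish identically (`isNormalizedLift_iterCoeffs_iff`).

For (1), iteration is given by homogeneous integral polynomials in the coefficients and commutes
with conjugation. Invariants therefore pull back along it, and semistability descends from the
iterate to the map (`IsSemistable.of_iterCoeffs`). Semistability forces minimality
(`isMinimalResultant_of_isSemistable`): an invariant whose value at the lift has absolute value 1
keeps that value under conjugation by SL₂, so every conjugated lift has a coefficient of absolute
value at least 1. The resultant is unchanged too, hence normalizing the conjugate can only increase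
its ord. This applies to φ and to φ^n.

For (2), work over the algebraically closed residue field (`iterPair_ne_zero`). If the two reduced
forms are independent, so are those of every iterate. Otherwise the pair is w · A with w a constant
vector, and every composition of it with itself brings in the scalar A(w). A nonzero iterate of
order at least 2 shows A(w) ≠ 0, and then no iterate vanishes. -/

/-- The value at `x` of the binary form of degree `d` with dehomogenization `f`. -/
def formEval (d : ℕ) (f : R[X]) (x : Fin 2 → S) : S :=
  MvPolynomial.aeval x (f.homogenize d)

lemma formEval_eq_sum (d : ℕ) (f : R[X]) (x : Fin 2 → S) :
    formEval d f x =
      ∑ j ∈ Finset.range (d + 1), algebraMap R S (f.coeff j) * x 0 ^ j * x 1 ^ (d - j) := by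
  rw [formEval, homogenize, map_sum, Finset.Nat.sum_antidiagonal_eq_sum_range_succ_mk]
  refine Finset.sum_congr rfl fun j _ => ?_
  rw [MvPolynomial.aeval_monomial, mul_assoc, Finsupp.prod_fintype _ _ (by simp)]
  simp

@[simp] lemma formEval_zero (d : ℕ) (x : Fin 2 → S) : formEval d (0 : R[X]) x = 0 := by
  simp [formEval]

@[simp] lemma formEval_one (d : ℕ) (x : Fin 2 → S) : formEval d (1 : R[X]) x = x 1 ^ d := by
  simp [formEval]

lemma formEval_add (d : ℕ) (f g : R[X]) (x : Fin 2 → S) :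
    formEval d (f + g) x = formEval d f x + formEval d g x := by
  simp [formEval]

lemma formEval_C_mul (d : ℕ) (c : R) (f : R[X]) (x : Fin 2 → S) :
    formEval d (C c * f) x = algebraMap R S c * formEval d f x := by
  simp [formEval]

lemma formEval_sum (d : ℕ) {ι : Type*} (s : Finset ι) (f : ι → R[X]) (x : Fin 2 → S) :
    formEval d (∑ i ∈ s, f i) x = ∑ i ∈ s, formEval d (f i) x := by
  simp [formEval]

lemma formEval_mul {d e : ℕ} {f g : R[X]} (hf : f.natDegree ≤ d) (hg : g.natDegree ≤ e)
    (x : Fin 2 → S) : formEval (d + e) (f * g) x = formEval d f x * formEval e g x := by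
  simp [formEval, homogenize_mul _ _ hf hg]

lemma formEval_pow {d : ℕ} {f : R[X]} (hf : f.natDegree ≤ d) (j : ℕ) (x : Fin 2 → S) :
    formEval (j * d) (f ^ j) x = formEval d f x ^ j := by
  induction j with
  | zero => simp
  | succ j ih =>
    rw [pow_succ, pow_succ, ← ih, add_mul, one_mul,
      formEval_mul (natDegree_pow_le_of_le j hf) hf]

lemma formEval_zero_deg (f : R[X]) (x : Fin 2 → S) :
    formEval 0 f x = algebraMap R S (f.coeff 0) := by
  simp [formEval_eq_sum]

lemma formEval_one_deg (f : R[X]) (x : Fin 2 → S) :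
    formEval 1 f x = algebraMap R S (f.coeff 0) * x 1 + algebraMap R S (f.coeff 1) * x 0 := by
  simp [formEval_eq_sum, Finset.sum_range_succ]

lemma formEval_smul (d : ℕ) (f : R[X]) (c : S) (x : Fin 2 → S) :
    formEval d f (fun i => c * x i) = c ^ d * formEval d f x := by
  simp only [formEval_eq_sum, Finset.mul_sum]
  refine Finset.sum_congr rfl fun j hj => ?_
  have : j + (d - j) = d := by have := Finset.mem_range.1 hj; omega
  conv_rhs => rw [← this, pow_add]
  rw [mul_pow, mul_pow]; simp only [this]; ring

lemma map_formEval {T : Type*} [CommRing T] [Algebra R T] (σ : S →ₐ[R] T) (d : ℕ) (f : R[X])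
    (x : Fin 2 → S) : σ (formEval d f x) = formEval d f (fun i => σ (x i)) := by
  simp [formEval_eq_sum]

lemma formEval_X_one {d : ℕ} {f : R[X]} (hf : f.natDegree ≤ d) :
    formEval d f ![X, 1] = f :=
  aeval_homogenize_X_one f hf

lemma formEval_of_eq_one {d : ℕ} {f : R[X]} (hf : f.natDegree ≤ d) (x : Fin 2 → S)
    (hx : x 1 = 1) : formEval d f x = aeval (x 0) f :=
  aeval_homogenize_of_eq_one hf x hx

lemma natDegree_formEval_le {d e : ℕ} (f : R[X]) {x : Fin 2 → R[X]}
    (hx : ∀ i, (x i).natDegree ≤ e) : (formEval d f x).natDegree ≤ d * e := by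
  rw [formEval_eq_sum]
  refine natDegree_sum_le_of_forall_le _ _ fun j hj => ?_
  have hj' : j + (d - j) = d := by have := Finset.mem_range.1 hj; omega
  refine natDegree_mul_le_of_le (natDegree_mul_le_of_le (m := 0) ?_
    (natDegree_pow_le_of_le j (hx 0))) (natDegree_pow_le_of_le (d - j) (hx 1)) |>.trans ?_
  · exact natDegree_C _ |>.le
  · rw [zero_add, ← add_mul, hj']

lemma map_formEval_ringHom {T : Type*} [CommRing T] (σ : R →+* T) (d : ℕ) (f : R[X])
    (x : Fin 2 → R[X]) :
    (formEval d f x).map σ = formEval d (f.map σ) (fun i => (x i).map σ) := by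
  simp [formEval_eq_sum, Polynomial.map_sum]

/-- Homogenization is taken at a formal degree, so the degree bound on `y` is what lets products and
powers of its entries be evaluated factor by factor. -/
lemma formEval_formEval {d e : ℕ} (f : R[X]) {y : Fin 2 → R[X]}
    (hy : ∀ i, (y i).natDegree ≤ e) (x : Fin 2 → S) :
    formEval (d * e) (formEval d f y) x = formEval d f (fun i => formEval e (y i) x) := by
  rw [formEval_eq_sum d f y, formEval_sum, formEval_eq_sum d f]
  refine Finset.sum_congr rfl fun j hj => ?_
  have hj' : j + (d - j) = d := by have := Finset.mem_range.1 hj; omega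
  have h : d * e = j * e + (d - j) * e := by rw [← add_mul, hj']
  rw [mul_assoc, mul_assoc, h]
  -- The coefficient appears as `algebraMap R R[X] _`, which is `C _` only up to unfolding.
  erw [formEval_C_mul]
  rw [formEval_mul (natDegree_pow_le_of_le j (hy 0)) (natDegree_pow_le_of_le (d - j) (hy 1)),
    formEval_pow (hy 0), formEval_pow (hy 1)]

end FormEval

/-! ### Composition of pairs of forms -/

section CompPair

variable {R : Type*} [CommRing R]

/-- The composition `p ∘ q` of pairs of binary forms, where `p` has degree `d`. -/
def compPair (d : ℕ) (p q : Fin 2 → R[X]) : Fin 2 → R[X] :=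
  fun i => formEval d (p i) q

/-- The iterates of a pair of binary forms of degree `d`. -/
def iterPair (d : ℕ) (p : Fin 2 → R[X]) : ℕ → Fin 2 → R[X]
  | 0 => ![X, 1]
  | n + 1 => compPair d p (iterPair d p n)

/-- A matrix acting on the left on pairs of forms. -/
def linPair (g : Matrix (Fin 2) (Fin 2) R) (p : Fin 2 → R[X]) : Fin 2 → R[X] :=
  fun i => ∑ l : Fin 2, C (g i l) * p l

/-- The pair of linear forms given by a matrix. -/
def matPair (g : Matrix (Fin 2) (Fin 2) R) : Fin 2 → R[X] :=
  fun i => C (g i 0) * X + C (g i 1)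

lemma natDegree_matPair_le (g : Matrix (Fin 2) (Fin 2) R) (i : Fin 2) :
    (matPair g i).natDegree ≤ 1 :=
  natDegree_linear_le

lemma natDegree_linPair_le {d : ℕ} (g : Matrix (Fin 2) (Fin 2) R) {p : Fin 2 → R[X]}
    (hp : ∀ i, (p i).natDegree ≤ d) (i : Fin 2) : (linPair g p i).natDegree ≤ d :=
  natDegree_sum_le_of_forall_le _ _ fun l _ => (natDegree_C_mul_le _ _).trans (hp l)

lemma natDegree_compPair_le {d e : ℕ} (p : Fin 2 → R[X]) {q : Fin 2 → R[X]}
    (hq : ∀ i, (q i).natDegree ≤ e) (i : Fin 2) : (compPair d p q i).natDegree ≤ d * e :=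
  natDegree_formEval_le _ hq

lemma natDegree_iterPair_le (d : ℕ) (p : Fin 2 → R[X]) (n : ℕ) (i : Fin 2) :
    (iterPair d p n i).natDegree ≤ d ^ n := by
  induction n generalizing i with
  | zero => fin_cases i <;> simp [iterPair, natDegree_X_le]
  | succ n ih => rw [pow_succ, mul_comm]; exact natDegree_compPair_le p ih i

lemma compPair_assoc {d e : ℕ} (p : Fin 2 → R[X]) {q : Fin 2 → R[X]}
    (hq : ∀ i, (q i).natDegree ≤ e) (r : Fin 2 → R[X]) :
    compPair (d * e) (compPair d p q) r = compPair d p (compPair e q r) :=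
  funext fun i => formEval_formEval (p i) hq r

lemma compPair_X_one {d : ℕ} {p : Fin 2 → R[X]} (hp : ∀ i, (p i).natDegree ≤ d) :
    compPair d p ![X, 1] = p :=
  funext fun i => formEval_X_one (hp i)

lemma X_one_compPair (q : Fin 2 → R[X]) : compPair 1 ![X, 1] q = q := by
  funext i
  fin_cases i <;> simp [compPair, formEval_one_deg, coeff_X]

lemma compPair_matPair (g : Matrix (Fin 2) (Fin 2) R) (q : Fin 2 → R[X]) :
    compPair 1 (matPair g) q = linPair g q := by
  funext i
  simp [compPair, matPair, linPair, formEval_one_deg, add_comm]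

lemma linPair_compPair (d : ℕ) (g : Matrix (Fin 2) (Fin 2) R) (p q : Fin 2 → R[X]) :
    compPair d (linPair g p) q = linPair g (compPair d p q) := by
  funext i
  simp only [compPair, linPair, formEval_sum, formEval_C_mul]
  rfl

lemma linPair_linPair (g h : Matrix (Fin 2) (Fin 2) R) (p : Fin 2 → R[X]) :
    linPair g (linPair h p) = linPair (g * h) p := by
  funext i
  simp [linPair, Matrix.mul_apply, Fin.sum_univ_two]
  ring

lemma linPair_one (p : Fin 2 → R[X]) : linPair 1 p = p := by
  funext i
  simp [linPair, Matrix.one_apply]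

lemma linPair_X_one (g : Matrix (Fin 2) (Fin 2) R) : linPair g ![X, 1] = matPair g := by
  funext i
  simp [linPair, matPair, Fin.sum_univ_two]

/-- The conjugate `g⁻¹ ∘ p ∘ g`. -/
def conjPair (d : ℕ) (g : Matrix.SpecialLinearGroup (Fin 2) R)
    (p : Fin 2 → R[X]) : Fin 2 → R[X] :=
  linPair g⁻¹.1 (compPair d p (matPair g.1))

lemma natDegree_conjPair_le {d : ℕ} (g : Matrix.SpecialLinearGroup (Fin 2) R)
    (p : Fin 2 → R[X]) (i : Fin 2) : (conjPair d g p i).natDegree ≤ d :=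
  natDegree_linPair_le _
    (fun i => (natDegree_compPair_le p (natDegree_matPair_le g.1) i).trans (mul_one d).le) i

/-- The inner `g` and `g⁻¹` cancel. With determinant 1 this is an identity of pairs of forms, with
no scalar factor. -/
lemma compPair_conjPair {d e : ℕ} (g : Matrix.SpecialLinearGroup (Fin 2) R)
    (p : Fin 2 → R[X]) {q : Fin 2 → R[X]} (hq : ∀ i, (q i).natDegree ≤ e) :
    compPair d (conjPair d g p) (conjPair e g q) = conjPair (d * e) g (compPair d p q) := by
  have h : compPair 1 (matPair g.1) (conjPair e g q) = compPair e q (matPair g.1) := by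
    rw [compPair_matPair, conjPair, linPair_linPair, ← Matrix.SpecialLinearGroup.coe_mul,
      mul_inv_cancel, Matrix.SpecialLinearGroup.coe_one, linPair_one]
  have h2 := compPair_assoc (d := d) p (natDegree_matPair_le g.1) (conjPair e g q)
  rw [mul_one] at h2
  rw [conjPair, linPair_compPair, h2, h, conjPair, compPair_assoc p hq]

lemma conjPair_X_one (g : Matrix.SpecialLinearGroup (Fin 2) R) :
    conjPair 1 g ![X, 1] = ![X, 1] := by
  rw [conjPair, X_one_compPair, ← linPair_X_one, linPair_linPair,
    ← Matrix.SpecialLinearGroup.coe_mul, inv_mul_cancel, Matrix.SpecialLinearGroup.coe_one,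
    linPair_one]

lemma iterPair_conjPair (d : ℕ) (g : Matrix.SpecialLinearGroup (Fin 2) R)
    (p : Fin 2 → R[X]) (n : ℕ) :
    iterPair d (conjPair d g p) n = conjPair (d ^ n) g (iterPair d p n) := by
  induction n with
  | zero => rw [pow_zero]; exact (conjPair_X_one g).symm
  | succ n ih =>
    rw [iterPair, ih, compPair_conjPair g p (natDegree_iterPair_le d p n), pow_succ, mul_comm]
    rfl

lemma map_iterPair {T : Type*} [CommRing T] (σ : R →+* T) (d : ℕ) (p : Fin 2 → R[X]) (n : ℕ)
    (i : Fin 2) :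
    (iterPair d p n i).map σ = iterPair d (fun i => (p i).map σ) n i := by
  induction n generalizing i with
  | zero => fin_cases i <;> simp [iterPair]
  | succ n ih => simp only [iterPair, compPair, map_formEval_ringHom, ih]

end CompPair

/-! ### Coefficient vectors -/

section IterCoeffs

variable {R : Type*} [CommRing R] {d : ℕ}

lemma conjCoeffs_eq (g : Matrix.SpecialLinearGroup (Fin 2) R) (a : Coeffs d R) :
    conjCoeffs g a = fun ij => (conjPair d g (coordPoly a) ij.1).coeff (ij.2 : ℕ) := by
  funext ij
  simp only [conjCoeffs, conjPair, linPair, compPair]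
  congr 2
  funext l
  congr 1
  rw [formEval_eq_sum, Finset.sum_range]
  refine Finset.sum_congr rfl fun j _ => ?_
  rw [coeff_coordPoly]
  rfl

lemma coordPoly_conjCoeffs (g : Matrix.SpecialLinearGroup (Fin 2) R) (a : Coeffs d R) :
    coordPoly (conjCoeffs g a) = conjPair d g (coordPoly a) := by
  funext i
  rw [conjCoeffs_eq]
  exact coordPoly_of_coeff _ i (natDegree_conjPair_le g _ i)

/-- The coefficients of the `n`-th iterate of a pair of forms. -/
def iterCoeffs (a : Coeffs d R) (n : ℕ) : Coeffs (d ^ n) R :=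
  fun ij => (iterPair d (coordPoly a) n ij.1).coeff (ij.2 : ℕ)

lemma coordPoly_iterCoeffs (a : Coeffs d R) (n : ℕ) :
    coordPoly (iterCoeffs a n) = iterPair d (coordPoly a) n :=
  funext fun i => coordPoly_of_coeff _ i (natDegree_iterPair_le d _ n i)

lemma iterCoeffs_conjCoeffs (g : Matrix.SpecialLinearGroup (Fin 2) R) (a : Coeffs d R)
    (n : ℕ) : iterCoeffs (conjCoeffs g a) n = conjCoeffs g (iterCoeffs a n) := by
  rw [conjCoeffs_eq g (iterCoeffs a n), coordPoly_iterCoeffs, ← iterPair_conjPair,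
    ← coordPoly_conjCoeffs]
  rfl

lemma map_coordPoly {T : Type*} [CommRing T] (σ : R →+* T) (a : Coeffs d R) (i : Fin 2) :
    (coordPoly a i).map σ = coordPoly (fun ij => σ (a ij)) i := by
  simp [coordPoly, Polynomial.map_sum]

lemma map_iterCoeffs {T : Type*} [CommRing T] (σ : R →+* T) (a : Coeffs d R) (n : ℕ)
    (ij : Fin 2 × Fin (d ^ n + 1)) :
    σ (iterCoeffs a n ij) = iterCoeffs (fun ij => σ (a ij)) n ij := by
  rw [iterCoeffs, iterCoeffs, ← coeff_map, map_iterPair]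
  simp only [map_coordPoly]

lemma coordPoly_eq_zero_iff (a : Coeffs d R) : (∀ i, coordPoly a i = 0) ↔ a = 0 := by
  constructor
  · intro h
    funext ⟨i, j⟩
    rw [← coeff_coordPoly a i j, h i]
    simp
  · rintro rfl i
    simp [coordPoly]

end IterCoeffs

/-! ### Pulling back invariants along iteration -/

section Invariants

lemma isHomogeneous_coeff_mul {σ R : Type*} [CommRing R] {p q : (MvPolynomial σ R)[X]}
    {s t : ℕ} (hp : ∀ i, (p.coeff i).IsHomogeneous s) (hq : ∀ i, (q.coeff i).IsHomogeneous t)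
    (i : ℕ) : ((p * q).coeff i).IsHomogeneous (s + t) := by
  rw [coeff_mul]
  exact MvPolynomial.IsHomogeneous.sum _ _ _ fun x _ => (hp _).mul (hq _)

lemma isHomogeneous_coeff_pow {σ R : Type*} [CommRing R] {p : (MvPolynomial σ R)[X]}
    {s : ℕ} (hp : ∀ i, (p.coeff i).IsHomogeneous s) (j i : ℕ) :
    ((p ^ j).coeff i).IsHomogeneous (j * s) := by
  induction j generalizing i with
  | zero =>
    rw [pow_zero, coeff_one, zero_mul]
    split_ifs
    · exact MvPolynomial.isHomogeneous_one _ _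
    · exact MvPolynomial.isHomogeneous_zero _ _ _
  | succ j ih =>
    rw [pow_succ, add_mul, one_mul]
    exact isHomogeneous_coeff_mul ih hp i

/-- Each term is one coefficient of `f` times `d` factors taken from `x`, whence the weight `s + d *
t`. -/
lemma isHomogeneous_coeff_formEval {σ R : Type*} [CommRing R] {d : ℕ}
    {f : (MvPolynomial σ R)[X]} {x : Fin 2 → (MvPolynomial σ R)[X]} {s t : ℕ}
    (hf : ∀ i, (f.coeff i).IsHomogeneous s) (hx : ∀ l i, ((x l).coeff i).IsHomogeneous t)
    (i : ℕ) : ((formEval d f x).coeff i).IsHomogeneous (s + d * t) := by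
  rw [formEval_eq_sum, finsetSum_coeff]
  refine MvPolynomial.IsHomogeneous.sum _ _ _ fun j hj => ?_
  have hj' : j + (d - j) = d := by have := Finset.mem_range.1 hj; omega
  have : s + d * t = s + j * t + (d - j) * t := by rw [add_assoc, ← add_mul, hj']
  rw [this]
  refine isHomogeneous_coeff_mul (isHomogeneous_coeff_mul (fun i => ?_)
    (isHomogeneous_coeff_pow (hx 0) j)) (isHomogeneous_coeff_pow (hx 1) _) i
  change ((C (f.coeff j)).coeff i).IsHomogeneous s
  rw [coeff_C]
  split_ifs
  · exact hf j
  · exact MvPolynomial.isHomogeneous_zero _ _ _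

/-- The generic pair of forms of degree `d`. -/
def genericCoeffs (d : ℕ) :
    Coeffs d (MvPolynomial (Fin 2 × Fin (d + 1)) ℤ) := MvPolynomial.X

lemma isHomogeneous_iterCoeffs_generic (d n : ℕ) (ij : Fin 2 × Fin (d ^ n + 1)) :
    (iterCoeffs (genericCoeffs d) n ij).IsHomogeneous (∑ l ∈ Finset.range n, d ^ l) := by
  suffices h : ∀ i j, ((iterPair d (coordPoly (genericCoeffs d)) n i).coeff j).IsHomogeneous
      (∑ l ∈ Finset.range n, d ^ l) from h _ _
  have hX : ∀ i j, ((coordPoly (genericCoeffs d) i).coeff j).IsHomogeneous 1 := by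
    intro i j
    by_cases hj : j < d + 1
    · have := coeff_coordPoly (genericCoeffs d) i ⟨j, hj⟩
      rw [show ((⟨j, hj⟩ : Fin (d + 1)) : ℕ) = j from rfl] at this
      rw [this]
      exact MvPolynomial.isHomogeneous_X _ _
    · rw [coeff_eq_zero_of_natDegree_lt
        ((natDegree_coordPoly_le (genericCoeffs d) i).trans_lt (by omega))]
      exact MvPolynomial.isHomogeneous_zero _ _ _
  clear ij
  induction n with
  | zero =>
    intro i j
    have h0 := MvPolynomial.isHomogeneous_zero (Fin 2 × Fin (d + 1)) ℤ 0
    have h1 := MvPolynomial.isHomogeneous_one (Fin 2 × Fin (d + 1)) ℤ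
    fin_cases i
    · simp only [iterPair, Fin.zero_eta, Matrix.cons_val_zero, coeff_X, Finset.range_zero,
        Finset.sum_empty]
      split_ifs
      exacts [h1, h0]
    · simp only [iterPair, Fin.mk_one, Matrix.cons_val_one, Matrix.cons_val_fin_one, coeff_one,
        Finset.range_zero, Finset.sum_empty]
      split_ifs
      exacts [h1, h0]
  | succ n ih =>
    intro i j
    have := isHomogeneous_coeff_formEval (d := d) (hX i) ih j
    -- Composing with the generic pair sends the weight `w` to `1 + d * w`, which generates the
    -- geometric sum.
    have hs : ∑ l ∈ Finset.range (n + 1), d ^ l = 1 + d * ∑ l ∈ Finset.range n, d ^ l := by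
      rw [Finset.sum_range_succ', pow_zero, add_comm, Finset.mul_sum]
      simp only [pow_succ']
    rw [hs]
    exact this

/-- The pullback of a form on pairs of degree `d ^ n` along the `n`-th iteration map. -/
def iterPullback (d n : ℕ) (H : MvPolynomial (Fin 2 × Fin (d ^ n + 1)) ℤ) :
    MvPolynomial (Fin 2 × Fin (d + 1)) ℤ :=
  MvPolynomial.aeval (iterCoeffs (genericCoeffs d) n) H

/-- Iteration commutes with ring homomorphisms, so the generic computation specializes to any
coefficients over any ring. Invariance of the pullback can then be checked on values. -/
lemma aeval_iterPullback {R : Type*} [CommRing R] {d n : ℕ}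
    (H : MvPolynomial (Fin 2 × Fin (d ^ n + 1)) ℤ) (a : Coeffs d R) :
    MvPolynomial.aeval a (iterPullback d n H) = MvPolynomial.aeval (iterCoeffs a n) H := by
  have h : ∀ ij, (MvPolynomial.aeval a : _ →ₐ[ℤ] R) (iterCoeffs (genericCoeffs d) n ij) =
      iterCoeffs a n ij := by
    intro ij
    have := map_iterCoeffs (MvPolynomial.aeval a : _ →ₐ[ℤ] R).toRingHom (genericCoeffs d) n ij
    simpa [genericCoeffs] using this
  have h2 : ((MvPolynomial.aeval a : _ →ₐ[ℤ] R).comp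
      (MvPolynomial.aeval (iterCoeffs (genericCoeffs d) n))) =
      MvPolynomial.aeval (iterCoeffs a n) := MvPolynomial.algHom_ext fun ij => by simp [h]
  exact congrArg (fun σ => σ H) h2

lemma IsSL2Invariant.iterPullback {d n : ℕ} {H : MvPolynomial (Fin 2 × Fin (d ^ n + 1)) ℤ}
    (hH : IsSL2Invariant.{u} H) : IsSL2Invariant.{u} (iterPullback d n H) := by
  intro R _ g a
  rw [aeval_iterPullback, aeval_iterPullback, iterCoeffs_conjCoeffs, hH R g]

lemma isHomogeneous_iterPullback {d n D : ℕ} {H : MvPolynomial (Fin 2 × Fin (d ^ n + 1)) ℤ}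
    (hH : H.IsHomogeneous D) :
    (iterPullback d n H).IsHomogeneous ((∑ l ∈ Finset.range n, d ^ l) * D) :=
  hH.aeval _ (isHomogeneous_iterCoeffs_generic d n)

/-- If the `n`-th iterate of a pair of forms is semistable, then so is the pair itself. -/
lemma IsSemistable.of_iterCoeffs {k : Type u} [Field k] {d n : ℕ} (hd : 0 < d) (hn : 0 < n)
    {a : Coeffs d k} (h : IsSemistable (iterCoeffs a n)) : IsSemistable a := by
  obtain ⟨D, H, hD, hH, hinv, hne⟩ := h
  refine ⟨_, iterPullback d n H, Nat.mul_pos ?_ hD, isHomogeneous_iterPullback hH,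
    hinv.iterPullback, by rwa [aeval_iterPullback]⟩
  exact Finset.sum_pos (fun l _ => pow_pos hd l) (Finset.nonempty_range_iff.2 hn.ne')

end Invariants

/-! ### Linear factors of binary forms -/

section LinearFactors

variable {k : Type*} [Field k] [IsAlgClosed k]

lemma exists_linear_factor {d : ℕ} {f : k[X]} (hf : f.natDegree ≤ d + 1) :
    ∃ l g : k[X], l.natDegree ≤ 1 ∧ g.natDegree ≤ d ∧ f = l * g := by
  by_cases h : f.natDegree ≤ d
  -- A drop in degree is a zero at infinity: the polynomial 1, at formal degree 1, is the linear
  -- form `Y`.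
  · exact ⟨1, f, by simp, h, (one_mul f).symm⟩
  have hf0 : f ≠ 0 := by rintro rfl; simp at h
  obtain ⟨x, hx⟩ := IsAlgClosed.exists_root f
    (by rw [degree_eq_natDegree hf0]; exact_mod_cast (by omega : f.natDegree ≠ 0))
  obtain ⟨g, hg⟩ := dvd_iff_isRoot.2 hx
  have hg0 : g ≠ 0 := by rintro rfl; exact hf0 (by rw [hg, mul_zero])
  have := natDegree_mul (X_sub_C_ne_zero x) hg0
  rw [← hg, natDegree_X_sub_C] at this
  exact ⟨X - C x, g, by simp, by omega, hg⟩

/-- If a nonzero binary form over an algebraically closed field vanishes at `x`, then the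
coordinates of `x` are linearly dependent. -/
lemma exists_linear_relation {S : Type*} [CommRing S] [IsDomain S] [Algebra k S] {d : ℕ}
    {f : k[X]} (hf : f.natDegree ≤ d) (hf0 : f ≠ 0) {x : Fin 2 → S} (h : formEval d f x = 0) :
    ∃ s t : k, (s ≠ 0 ∨ t ≠ 0) ∧ algebraMap k S s * x 0 + algebraMap k S t * x 1 = 0 := by
  induction d generalizing f with
  | zero =>
    obtain ⟨c, rfl⟩ := natDegree_eq_zero.1 (Nat.le_zero.1 hf)
    rw [formEval_zero_deg, coeff_C_zero, map_eq_zero] at h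
    exact absurd (by rw [h, C_0]) hf0
  | succ d ih =>
    obtain ⟨l, g, hl, hg, rfl⟩ := exists_linear_factor hf
    rw [add_comm, formEval_mul hl hg] at h
    rcases mul_eq_zero.1 h with h | h
    -- The relation is the vanishing linear factor itself. It is nontrivial because the whole form
    -- is nonzero.
    · refine ⟨l.coeff 1, l.coeff 0, ?_, by rw [formEval_one_deg] at h; rw [← h, add_comm]⟩
      by_contra! hc
      apply hf0
      rw [eq_X_add_C_of_natDegree_le_one hl, hc.1, hc.2]
      simp
    · exact ih hg (right_ne_zero_of_mul hf0) h

end LinearFactors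

/-! ### The resultant of a composition -/

section ResultantComp

variable {K : Type*} [Field K]

/-- When formal degrees exceed actual ones, the resultant acquires powers of a sign and of a
coefficient of `g`, and these correction factors multiply. A zero product is treated apart, since
`natDegree` is then not additive. -/
lemma resultant_mul_left_of_le {f₁ f₂ g : K[X]} {m₁ m₂ n : ℕ} (h₁ : f₁.natDegree ≤ m₁)
    (h₂ : f₂.natDegree ≤ m₂) (hg : g.natDegree ≤ n) :
    resultant (f₁ * f₂) g (m₁ + m₂) n = resultant f₁ g m₁ n * resultant f₂ g m₂ n := by
  have hzero : ∀ m, resultant 0 g m n = 0 ^ n * g.coeff 0 ^ m :=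
    fun m => resultant_zero_left _ _ _
  by_cases h : f₁ * f₂ = 0
  · rcases Nat.eq_zero_or_pos n with rfl | hn
    · simp [pow_add]
    · rw [h, hzero, zero_pow hn.ne', zero_mul]
      rcases mul_eq_zero.1 h with rfl | rfl
      · rw [hzero, zero_pow hn.ne', zero_mul, zero_mul]
      · rw [hzero, zero_pow hn.ne', zero_mul, mul_zero]
  obtain ⟨a, rfl⟩ := Nat.exists_eq_add_of_le h₁
  obtain ⟨b, rfl⟩ := Nat.exists_eq_add_of_le h₂
  have hd := natDegree_mul (left_ne_zero_of_mul h) (right_ne_zero_of_mul h)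
  rw [show f₁.natDegree + a + (f₂.natDegree + b) = f₁.natDegree + f₂.natDegree + (a + b) by ring,
    resultant_add_left_deg _ _ _ _ _ hd.le, resultant_mul_left _ _ _ _ hg,
    resultant_add_left_deg _ _ _ _ _ le_rfl, resultant_add_left_deg _ _ _ _ _ le_rfl]
  ring

lemma resultant_mul_right_of_le {f g₁ g₂ : K[X]} {m n₁ n₂ : ℕ} (h₁ : g₁.natDegree ≤ n₁)
    (h₂ : g₂.natDegree ≤ n₂) (hf : f.natDegree ≤ m) :
    resultant f (g₁ * g₂) m (n₁ + n₂) = resultant f g₁ m n₁ * resultant f g₂ m n₂ := by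
  rw [resultant_comm, resultant_mul_left_of_le h₁ h₂ hf, resultant_comm f g₁,
    resultant_comm f g₂]
  ring

/-- Row reduction of the 2 × 2 matrix: adding a multiple of one form to the other preserves the
resultant, and scaling either form gives an `e`-th power. If `a = 0`, the two forms are swapped
instead. -/
lemma resultant_linear_comb {P Q : K[X]} {e : ℕ} (hP : P.natDegree ≤ e) (hQ : Q.natDegree ≤ e)
    (a b c d : K) :
    resultant (C a * P + C b * Q) (C c * P + C d * Q) e e =
      (a * d - b * c) ^ e * resultant P Q e e := by
  have hadd : ∀ f g : K[X], f.natDegree ≤ e → ∀ t : K,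
      resultant f (g + f * C t) e e = resultant f g e e := fun f g hf t =>
    resultant_add_mul_right _ _ _ _ _ (by simp) hf
  have hlin : ∀ s t : K, (C s * P + C t * Q).natDegree ≤ e := fun s t =>
    natDegree_add_le_of_degree_le ((natDegree_C_mul_le _ _).trans hP)
      ((natDegree_C_mul_le _ _).trans hQ)
  by_cases ha : a = 0
  · subst ha
    rw [C_0, zero_mul, zero_add, resultant_C_mul_left, mul_comm (C d), hadd Q _ hQ,
      resultant_C_mul_right, resultant_comm Q P]
    -- The swap produces the sign `(-1) ^ (e * e)`, and `e * e` has the parity of `e`.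
    have : ((-1 : K)) ^ (e * e) = (-1) ^ e := by
      rcases Nat.even_or_odd e with h | h
      · rw [h.neg_one_pow, (h.mul_left e).neg_one_pow]
      · rw [h.neg_one_pow, (h.mul h).neg_one_pow]
    rw [this, zero_mul, zero_sub, neg_pow (b * c)]
    ring
  · have e1 : C c * P + C d * Q = C (d - b * c / a) * Q + (C a * P + C b * Q) * C (c / a) := by
      have h1 : C a * C (c / a) = C c := by rw [← C_mul, mul_div_cancel₀ _ ha]
      have h2 : C b * C (c / a) = C (b * c / a) := by rw [← C_mul, mul_div_assoc]
      rw [C_sub, ← h2]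
      linear_combination -P * h1
    have h3 := resultant_add_mul_left (C a * P) Q (C b) e e (by simp) hQ
    rw [e1, hadd _ _ (hlin a b), resultant_C_mul_right, mul_comm (C b) Q, h3,
      resultant_C_mul_left, ← mul_assoc, ← mul_pow]
    congr 2
    field_simp

variable [IsAlgClosed K]

/-- Split `g` into linear factors and use multiplicativity. Two linear forms in `q 0`, `q 1` are
covered by `resultant_linear_comb`. -/
lemma resultant_formEval_linear {q : Fin 2 → K[X]} {e n : ℕ} (hq : ∀ i, (q i).natDegree ≤ e)
    {l g : K[X]} (hl : l.natDegree ≤ 1) (hg : g.natDegree ≤ n) :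
    resultant (formEval 1 l q) (formEval n g q) e (n * e) =
      resultant l g 1 n ^ e * resultant (q 0) (q 1) e e ^ n := by
  induction n generalizing g with
  | zero =>
    obtain ⟨c, rfl⟩ := natDegree_eq_zero.1 (Nat.le_zero.1 hg)
    rw [formEval_zero_deg]
    simp
  | succ n ih =>
    obtain ⟨m, g', hm, hg', rfl⟩ := exists_linear_factor hg
    have hle : ∀ f : K[X], (formEval 1 f q).natDegree ≤ e := fun f => by
      simpa using natDegree_formEval_le (d := 1) f hq
    rw [add_comm, formEval_mul hm hg', add_mul, one_mul,
      resultant_mul_right_of_le (hle m) (natDegree_formEval_le _ hq) (hle l), ih hg',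
      resultant_mul_right_of_le hm hg' hl]
    have key : ∀ a b c d : K, resultant (C a * X + C b : K[X]) (C c * X + C d) 1 1 =
        a * d - b * c := fun a b c d => by
      have := resultant_linear_comb (e := 1) (P := (X : K[X])) (Q := 1) natDegree_X_le
        (by simp) a b c d
      rwa [mul_one, mul_one, resultant_one_right, coeff_X_one, pow_one, pow_one, mul_one] at this
    have h1 : resultant (formEval 1 l q) (formEval 1 m q) e e =
        resultant l m 1 1 ^ e * resultant (q 0) (q 1) e e := by
      rw [formEval_one_deg, formEval_one_deg, add_comm, add_comm (algebraMap K K[X] (m.coeff 0) * _)]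
      simp only [← C_eq_algebraMap]
      rw [resultant_linear_comb (hq 0) (hq 1)]
      conv_rhs => rw [eq_X_add_C_of_natDegree_le_one hl, eq_X_add_C_of_natDegree_le_one hm, key]
    rw [h1]
    ring

/-- The resultant of a composition of pairs of binary forms. -/
lemma resultant_formEval {q : Fin 2 → K[X]} {e m n : ℕ} (hq : ∀ i, (q i).natDegree ≤ e)
    {f g : K[X]} (hf : f.natDegree ≤ m) (hg : g.natDegree ≤ n) :
    resultant (formEval m f q) (formEval n g q) (m * e) (n * e) =
      resultant f g m n ^ e * resultant (q 0) (q 1) e e ^ (m * n) := by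
  induction m generalizing f with
  | zero =>
    obtain ⟨c, rfl⟩ := natDegree_eq_zero.1 (Nat.le_zero.1 hf)
    rw [formEval_zero_deg]
    simp [pow_mul]
  | succ m ih =>
    obtain ⟨l, f', hl, hf', rfl⟩ := exists_linear_factor hf
    have hle : (formEval 1 l q).natDegree ≤ e := by
      simpa using natDegree_formEval_le (d := 1) l hq
    rw [add_comm, formEval_mul hl hf', add_mul, one_mul,
      resultant_mul_left_of_le hle (natDegree_formEval_le _ hq) (natDegree_formEval_le _ hq),
      ih hf', resultant_mul_left_of_le hl hf' hg, resultant_formEval_linear hq hl hg]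
    ring

lemma resultant_compPair {d e : ℕ} {p q : Fin 2 → K[X]} (hp : ∀ i, (p i).natDegree ≤ d)
    (hq : ∀ i, (q i).natDegree ≤ e) :
    resultant (compPair d p q 0) (compPair d p q 1) (d * e) (d * e) =
      resultant (p 0) (p 1) d d ^ e * resultant (q 0) (q 1) e e ^ (d * d) :=
  resultant_formEval hq (hp 0) (hp 1)

end ResultantComp

lemma resultant_matPair {K : Type*} [Field K] (g : Matrix (Fin 2) (Fin 2) K) :
    resultant (matPair g 0) (matPair g 1) 1 1 = g.det := by
  have := resultant_linear_comb (e := 1) (P := (X : K[X])) (Q := 1) natDegree_X_le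
    (by simp) (g 0 0) (g 0 1) (g 1 0) (g 1 1)
  rw [mul_one, mul_one, resultant_one_right, coeff_X_one, pow_one, pow_one, mul_one] at this
  rw [Matrix.det_fin_two]
  exact this

/-- The composition formula applies on both sides of the pair, and the two linear pairs have
resultant equal to a determinant, here 1. -/
lemma resForm_conjCoeffs {K : Type*} [Field K] [IsAlgClosed K] {d : ℕ}
    (g : Matrix.SpecialLinearGroup (Fin 2) K) (a : Coeffs d K) :
    resForm (conjCoeffs g a) = resForm a := by
  have hc : ∀ i, (compPair d (coordPoly a) (matPair g.1) i).natDegree ≤ d := fun i =>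
    (natDegree_compPair_le _ (natDegree_matPair_le g.1) i).trans (mul_one d).le
  have h1 := resultant_compPair (natDegree_matPair_le g⁻¹.1) hc
  have h2 := resultant_compPair (natDegree_coordPoly_le a) (natDegree_matPair_le g.1)
  rw [resultant_matPair, g.2, one_pow, mul_one, mul_one, pow_one] at h2
  rw [resultant_matPair, g⁻¹.2, one_pow, one_mul, one_mul, one_mul, pow_one, h2,
    compPair_matPair] at h1
  rw [resForm, coordPoly_conjCoeffs]
  exact h1

/-! ### Vanishing of iterates -/

section Vanishing

variable {k : Type*} [Field k]

/-- The two forms of a pair are linearly independent. -/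
def IndepPair (p : Fin 2 → k[X]) : Prop :=
  ∀ s t : k, C s * p 0 + C t * p 1 = 0 → s = 0 ∧ t = 0

lemma IndepPair.ne_zero {p : Fin 2 → k[X]} (h : IndepPair p) : p ≠ 0 := by
  rintro rfl
  exact one_ne_zero (h 1 0 (by simp)).1

lemma indepPair_X_one : IndepPair ![(X : k[X]), 1] := by
  intro s t h
  have h0 := congrArg (fun q => q.coeff 0) h
  have h1 := congrArg (fun q => q.coeff 1) h
  exact ⟨by simpa [coeff_one] using h1, by simpa using h0⟩

/-- A relation between the composed forms says that the form `s p₀ + t p₁` vanishes at `q`. Unless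
it is zero, one of its linear factors vanishes at `q`, contradicting independence of `q`. -/
lemma IndepPair.compPair [IsAlgClosed k] {d : ℕ} {p q : Fin 2 → k[X]}
    (hd : ∀ i, (p i).natDegree ≤ d) (hp : IndepPair p) (hq : IndepPair q) :
    IndepPair (compPair d p q) := by
  intro s t h
  have e : formEval d (C s * p 0 + C t * p 1) q = 0 := by
    rw [formEval_add, formEval_C_mul, formEval_C_mul]; exact h
  apply hp
  by_contra hne
  obtain ⟨s', t', hst, h'⟩ := exists_linear_relation
    (natDegree_add_le_of_degree_le ((natDegree_C_mul_le _ _).trans (hd 0))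
      ((natDegree_C_mul_le _ _).trans (hd 1))) hne e
  have := hq s' t' h'
  tauto

lemma exists_eq_C_mul_of_not_indepPair {p : Fin 2 → k[X]} (h : ¬ IndepPair p) :
    ∃ (w : Fin 2 → k) (A : k[X]), p = fun i => C (w i) * A := by
  simp only [IndepPair, not_forall] at h
  obtain ⟨s, t, h, hst⟩ := h
  by_cases hs : s = 0
  · subst hs
    have ht : t ≠ 0 := fun ht => hst ⟨rfl, ht⟩
    have hp1 : p 1 = 0 := by simpa [ht] using h
    refine ⟨![1, 0], p 0, funext fun i => ?_⟩
    fin_cases i <;> simp [hp1]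
  · refine ⟨![-(t / s), 1], p 1, funext fun i => ?_⟩
    fin_cases i
    · have e : C s⁻¹ * C s = (1 : k[X]) := by rw [← C_mul, inv_mul_cancel₀ hs, C_1]
      simp only [Fin.zero_eta, Matrix.cons_val_zero, div_eq_inv_mul, C_neg, C_mul]
      linear_combination C s⁻¹ * h - p 0 * e
    · simp

lemma compPair_zero {d : ℕ} (hd : 0 < d) (p : Fin 2 → k[X]) : compPair d p 0 = 0 := by
  funext i
  have := formEval_smul d (p i) 0 (0 : Fin 2 → k[X])
  simp only [zero_pow hd.ne', zero_mul] at this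
  exact this

/-- A dependent pair is a constant map to `w` times a form, so composition preserves the shape `w ·
B`. The scalar `A(w)` decides whether it vanishes. -/
lemma compPair_C_mul (d : ℕ) (w : Fin 2 → k) (A B : k[X]) :
    compPair d (fun i => C (w i) * A) (fun i => C (w i) * B) =
      fun i => C (w i) * (B ^ d * formEval d A (fun i => C (w i))) := by
  funext i
  simp only [compPair]
  rw [formEval_C_mul, ← formEval_smul]
  simp only [mul_comm B]
  rfl

/-- If some iterate of order at least `2` of a pair of forms does not vanish identically, then
no iterate does. -/
lemma iterPair_ne_zero [IsAlgClosed k] {d : ℕ} (hd : 0 < d) {p : Fin 2 → k[X]}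
    (hp : ∀ i, (p i).natDegree ≤ d) {n : ℕ} (hn : 2 ≤ n) (h : iterPair d p n ≠ 0) (m : ℕ) :
    iterPair d p m ≠ 0 := by
  by_cases hi : IndepPair p
  · apply IndepPair.ne_zero
    induction m with
    | zero => exact indepPair_X_one
    | succ m ih => exact hi.compPair hp ih
  -- Here `2 ≤ n` matters: with `A(w) = 0` the pair `w · A` may be nonzero while its second iterate
  -- is zero. Once an iterate is zero, all later ones are.
  have h2 : compPair d p p ≠ 0 := by
    intro h0
    apply h
    induction n, hn using Nat.le_induction with
    | base => simpa only [iterPair, compPair_X_one hp] using h0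
    | succ n _ ih =>
      by_cases hz : iterPair d p n = 0
      · rw [iterPair, hz, compPair_zero hd]
      · exact absurd (ih hz) hz
  obtain ⟨w, A, rfl⟩ := exists_eq_C_mul_of_not_indepPair hi
  rw [compPair_C_mul] at h2
  have hw : ∃ i, w i ≠ 0 := by
    by_contra! hw
    exact h2 (funext fun i => by simp [hw])
  have hA : A ≠ 0 := by
    rintro rfl
    exact h2 (funext fun i => by simp)
  have hc : formEval d A (fun i => C (w i)) ≠ 0 := by
    intro hc
    exact h2 (funext fun i => by simp [hc])
  have key : ∀ m, ∃ B : k[X], B ≠ 0 ∧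
      iterPair d (fun i => C (w i) * A) (m + 1) = fun i => C (w i) * B := by
    intro m
    induction m with
    | zero => exact ⟨A, hA, compPair_X_one hp⟩
    | succ m ih =>
      obtain ⟨B, hB, e⟩ := ih
      exact ⟨_, mul_ne_zero (pow_ne_zero d hB) hc, by rw [iterPair, e, compPair_C_mul]⟩
  cases m with
  | zero => exact indepPair_X_one.ne_zero
  | succ m =>
    obtain ⟨B, hB, e⟩ := key m
    obtain ⟨i, hi⟩ := hw
    intro h0
    rw [e] at h0
    simpa [hi, hB] using congrFun h0 i

end Vanishing

/-! ### Lifts of compositions, iterates and conjugates -/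

section Lifts

variable {K : Type*} [Field K]

/-- The pair of forms `p` of degree `d` is a homogeneous lift of `φ`. -/
def IsLiftPair (d : ℕ) (φ : RatFunc K) (p : Fin 2 → K[X]) : Prop :=
  resultant (p 0) (p 1) d d ≠ 0 ∧ p 1 ≠ 0 ∧
    φ = algebraMap K[X] (RatFunc K) (p 0) / algebraMap K[X] (RatFunc K) (p 1)

lemma IsLift.isLiftPair {d : ℕ} {φ : RatFunc K} {a : Coeffs d K} (h : IsLift φ a) :
    IsLiftPair d φ (coordPoly a) := h

lemma isLiftPair_mobius {γ : Matrix.GeneralLinearGroup (Fin 2) K}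
    {g : Matrix.SpecialLinearGroup (Fin 2) K} {c : K} (hc : c ≠ 0) (h : γ.1 = c • g.1) :
    IsLiftPair 1 (mobius γ) (matPair g.1) := by
  have hdet := resultant_matPair g.1
  rw [g.2] at hdet
  refine ⟨by rw [hdet]; exact one_ne_zero, ?_, ?_⟩
  · intro h0
    rw [h0] at hdet
    simp at hdet
  · have hc' : RatFunc.C c ≠ 0 := by simpa using hc
    simp only [mobius, h, Matrix.smul_apply, smul_eq_mul, map_mul, matPair, map_add,
      RatFunc.algebraMap_C, RatFunc.algebraMap_X, mul_assoc, ← mul_add]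
    rw [mul_div_mul_left _ _ hc']

lemma algebraMap_formEval (d : ℕ) {f : K[X]} (hf : f.natDegree ≤ d) {q : Fin 2 → K[X]}
    (hq : q 1 ≠ 0) :
    algebraMap K[X] (RatFunc K) (formEval d f q) =
      algebraMap K[X] (RatFunc K) (q 1) ^ d *
        f.eval₂ RatFunc.C (algebraMap K[X] (RatFunc K) (q 0) /
          algebraMap K[X] (RatFunc K) (q 1)) := by
  have hq' : algebraMap K[X] (RatFunc K) (q 1) ≠ 0 := by simpa using hq
  set ψ := algebraMap K[X] (RatFunc K) (q 0) / algebraMap K[X] (RatFunc K) (q 1) with hψ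
  have h1 := map_formEval (IsScalarTower.toAlgHom K K[X] (RatFunc K)) d f q
  have h2 : (fun i => IsScalarTower.toAlgHom K K[X] (RatFunc K) (q i)) =
      fun i => algebraMap K[X] (RatFunc K) (q 1) * (![ψ, 1] : Fin 2 → RatFunc K) i := by
    funext i
    fin_cases i
    · exact (mul_div_cancel₀ _ hq').symm
    · exact (mul_one _).symm
  rw [h2, formEval_smul, formEval_of_eq_one hf ![ψ, 1] rfl] at h1
  exact h1

lemma IsLiftPair.comp [IsAlgClosed K] {d e : ℕ} (hd : 0 < d) (he : 0 < e) {φ ψ : RatFunc K}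
    {p q : Fin 2 → K[X]} (hp : ∀ i, (p i).natDegree ≤ d) (hq : ∀ i, (q i).natDegree ≤ e)
    (hφ : IsLiftPair d φ p) (hψ : IsLiftPair e ψ q) :
    IsLiftPair (d * e) (comp φ ψ) (compPair d p q) := by
  have hres : resultant (compPair d p q 0) (compPair d p q 1) (d * e) (d * e) ≠ 0 := by
    rw [resultant_compPair hp hq]
    exact mul_ne_zero (pow_ne_zero _ hφ.1) (pow_ne_zero _ hψ.1)
  have hne : compPair d p q 1 ≠ 0 := by
    intro h0
    -- Positivity of both degrees makes the exponent of 0 positive, so a zero second form would kill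
    -- the resultant.
    rw [h0, resultant_zero_right, zero_pow (Nat.mul_pos hd he).ne', zero_mul] at hres
    exact hres rfl
  refine ⟨hres, hne, ?_⟩
  have ha : ∀ i, coordPoly (d := d) (fun ij => (p ij.1).coeff (ij.2 : ℕ)) i = p i := fun i =>
    coordPoly_of_coeff p i (hp i)
  have hlift : IsLift (d := d) φ (fun ij => (p ij.1).coeff (ij.2 : ℕ)) := by
    refine ⟨?_, ?_, ?_⟩
    · rw [resForm, ha, ha]; exact hφ.1
    · rw [ha]; exact hφ.2.1
    · rw [ha, ha]; exact hφ.2.2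
  -- `comp` evaluates the reduced fraction of `φ`, from which `p` differs by the constant `c`, which
  -- cancels in the quotient.
  obtain ⟨-, c, hc, h0, h1⟩ := hlift.eq_smul
  rw [ha] at h0 h1
  have hq' : algebraMap K[X] (RatFunc K) (q 1) ^ d ≠ 0 :=
    pow_ne_zero _ (by simpa using hψ.2.1)
  have hc' : RatFunc.C c ≠ 0 := by simpa using hc
  simp only [compPair]
  rw [algebraMap_formEval d (hp 0) hψ.2.1, algebraMap_formEval d (hp 1) hψ.2.1, ← hψ.2.2,
    mul_div_mul_left _ _ hq', h0, h1, eval₂_mul, eval₂_mul, eval₂_C, mul_div_mul_left _ _ hc']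
  rfl

lemma isLiftPair_iter [IsAlgClosed K] {d : ℕ} (hd : 0 < d) {φ : RatFunc K}
    {p : Fin 2 → K[X]} (hp : ∀ i, (p i).natDegree ≤ d) (hφ : IsLiftPair d φ p) (n : ℕ) :
    IsLiftPair (d ^ n) (iter φ n) (iterPair d p n) := by
  induction n with
  | zero =>
    refine ⟨?_, ?_, ?_⟩
    · change resultant (X : K[X]) 1 1 1 ≠ 0
      rw [resultant_one_right, coeff_X_one, one_pow]
      exact one_ne_zero
    · exact one_ne_zero
    · simp [iter, iterPair]
  | succ n ih =>
    rw [pow_succ, mul_comm]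
    exact hφ.comp hd (pow_pos hd n) hp (natDegree_iterPair_le d p n) ih

lemma isLift_iter [IsAlgClosed K] {d : ℕ} (hd : 0 < d) {φ : RatFunc K} {a : Coeffs d K}
    (h : IsLift φ a) (n : ℕ) : IsLift (iter φ n) (iterCoeffs a n) := by
  have := isLiftPair_iter hd (natDegree_coordPoly_le a) h.isLiftPair n
  rw [← coordPoly_iterCoeffs] at this
  exact this

lemma isLift_conj [IsAlgClosed K] {d : ℕ} (hd : 0 < d) {φ : RatFunc K} {a : Coeffs d K}
    (h : IsLift φ a) {γ : Matrix.GeneralLinearGroup (Fin 2) K}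
    {g : Matrix.SpecialLinearGroup (Fin 2) K} {c : K} (hc : c ≠ 0) (hg : γ.1 = c • g.1) :
    IsLift (conj φ γ) (conjCoeffs g a) := by
  have hinv : (γ⁻¹).1 = c⁻¹ • (g⁻¹).1 := by
    rw [Matrix.coe_units_inv]
    refine Matrix.inv_eq_right_inv ?_
    rw [hg, Matrix.smul_mul, Matrix.mul_smul, smul_smul, mul_inv_cancel₀ hc, one_smul,
      ← Matrix.SpecialLinearGroup.coe_mul, mul_inv_cancel, Matrix.SpecialLinearGroup.coe_one]
  have h1 := h.isLiftPair.comp hd one_pos (natDegree_coordPoly_le a)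
    (natDegree_matPair_le g.1) (isLiftPair_mobius hc hg)
  rw [mul_one] at h1
  have h2 := (isLiftPair_mobius (inv_ne_zero hc) hinv).comp one_pos hd
    (natDegree_matPair_le _)
    (fun i => (natDegree_compPair_le (coordPoly a) (natDegree_matPair_le g.1) i).trans
      (mul_one d).le) h1
  rw [one_mul, compPair_matPair] at h2
  have e : conjPair d g (coordPoly a) = coordPoly (conjCoeffs g a) :=
    (coordPoly_conjCoeffs g a).symm
  rw [conjPair] at e
  rw [e] at h2
  exact h2

/-- A square root of the determinant exists, so every class in PGL₂ has a representative in SL₂,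
where invariants and the resultant are unchanged. -/
lemma exists_eq_smul_specialLinear [IsAlgClosed K] (γ : Matrix.GeneralLinearGroup (Fin 2) K) :
    ∃ (c : K) (g : Matrix.SpecialLinearGroup (Fin 2) K), c ≠ 0 ∧ γ.1 = c • g.1 := by
  have hdet : γ.1.det ≠ 0 := by
    rw [← Matrix.GeneralLinearGroup.val_det_apply]
    exact Units.ne_zero _
  obtain ⟨c, hc⟩ := IsAlgClosed.exists_pow_nat_eq γ.1.det (n := 2) two_pos
  have hc0 : c ≠ 0 := by rintro rfl; exact hdet (by rw [← hc]; simp)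
  refine ⟨c, ⟨c⁻¹ • γ.1, ?_⟩, hc0, ?_⟩
  · rw [Matrix.det_smul, Fintype.card_fin, ← hc, ← mul_pow, inv_mul_cancel₀ hc0, one_pow]
  · simp [smul_smul, hc0]

lemma coordPoly_smul {d : ℕ} {R : Type*} [CommRing R] (c : R) (a : Coeffs d R) (i : Fin 2) :
    coordPoly (fun ij => c * a ij) i = C c * coordPoly a i := by
  simp only [coordPoly, Finset.mul_sum, C_mul, mul_assoc]

lemma resForm_smul {d : ℕ} {R : Type*} [CommRing R] (c : R) (a : Coeffs d R) :
    resForm (fun ij => c * a ij) = c ^ (2 * d) * resForm a := by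
  rw [resForm, coordPoly_smul, coordPoly_smul, resultant_C_mul_left, resultant_C_mul_right,
    resForm]
  ring

lemma IsLift.smul {d : ℕ} {φ : RatFunc K} {a : Coeffs d K} (h : IsLift φ a) {c : K}
    (hc : c ≠ 0) : IsLift φ (fun ij => c * a ij) := by
  refine ⟨?_, ?_, ?_⟩
  · rw [resForm_smul]
    exact mul_ne_zero (pow_ne_zero _ hc) h.1
  · rw [coordPoly_smul]
    exact mul_ne_zero (by simpa using hc) h.2.1
  · rw [coordPoly_smul, coordPoly_smul, map_mul, map_mul, mul_div_mul_left _ _ (by simpa using hc)]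
    exact h.2.2

lemma IsLift.ne_zero {d : ℕ} {φ : RatFunc K} {a : Coeffs d K} (h : IsLift φ a) : a ≠ 0 := by
  intro h0
  exact h.2.1 ((coordPoly_eq_zero_iff a).2 h0 1)

lemma resForm_iterCoeffs_succ [IsAlgClosed K] {d : ℕ} (a : Coeffs d K) (n : ℕ) :
    resForm (iterCoeffs a (n + 1)) =
      resForm a ^ (d ^ n) * resForm (iterCoeffs a n) ^ (d * d) := by
  have := resultant_compPair (natDegree_coordPoly_le a)
    (natDegree_iterPair_le d (coordPoly a) n)
  rw [mul_comm d (d ^ n), ← pow_succ] at this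
  rw [resForm, resForm, resForm, coordPoly_iterCoeffs, coordPoly_iterCoeffs]
  exact this

lemma resForm_iterCoeffs_zero {d : ℕ} (a : Coeffs d K) : resForm (iterCoeffs a 0) = 1 := by
  rw [resForm, coordPoly_iterCoeffs]
  change resultant (X : K[X]) 1 1 1 = 1
  rw [resultant_one_right, coeff_X_one, one_pow]

end Lifts

/-! ### Values of integral polynomials -/

lemma aeval_smul_of_isHomogeneous {σ R : Type*} [CommRing R] {D : ℕ} [Fintype σ]
    {H : MvPolynomial σ ℤ} (hH : H.IsHomogeneous D) (t : R) (x : σ → R) :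
    MvPolynomial.aeval (fun i => t * x i) H = t ^ D * MvPolynomial.aeval x H := by
  rw [MvPolynomial.aeval_def, MvPolynomial.aeval_def, MvPolynomial.eval₂_eq',
    MvPolynomial.eval₂_eq', Finset.mul_sum]
  refine Finset.sum_congr rfl fun m hm => ?_
  have hdeg : ∑ i, m i = D := by
    rw [← Finsupp.degree_eq_sum, Finsupp.degree_eq_weight_one]
    exact hH (MvPolynomial.mem_support_iff.1 hm)
  simp only [mul_pow, Finset.prod_mul_distrib, Finset.prod_pow_eq_pow_sum, hdeg]
  ring

lemma map_aeval_int {σ R S : Type*} [CommRing R] [CommRing S] (f : R →+* S) (x : σ → R)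
    (H : MvPolynomial σ ℤ) :
    f (MvPolynomial.aeval x H) = MvPolynomial.aeval (fun i => f (x i)) H := by
  have h : (f.toIntAlgHom.comp (MvPolynomial.aeval x)) =
      MvPolynomial.aeval (fun i => f (x i)) := MvPolynomial.algHom_ext fun i => by simp
  exact congrArg (fun σ => σ H) h

/-! ### Absolute values -/

lemma exists_max_norm {K : Type*} [NormedField K] {d : ℕ} {a : Coeffs d K} (ha : a ≠ 0) :
    ∃ m, a m ≠ 0 ∧ ∀ ij, ‖a ij‖ ≤ ‖a m‖ := by
  obtain ⟨m, hm⟩ := Finite.exists_max (fun ij => ‖a ij‖)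
  refine ⟨m, fun h0 => ha (funext fun ij => ?_), hm⟩
  have := hm ij
  rw [h0, norm_zero] at this
  exact norm_le_zero_iff.1 this

section NonArch

variable {K : Type u} [NormedField K] [IsUltrametricDist K]

lemma mem_integers_iff {x : K} : x ∈ Integers K ↔ ‖x‖ ≤ 1 := by
  rw [Valuation.mem_valuationSubring_iff]
  exact Iff.rfl

lemma residue_ne_zero_iff (x : Integers K) :
    IsLocalRing.residue (Integers K) x ≠ 0 ↔ ‖(x : K)‖ = 1 := by
  rw [IsLocalRing.residue_ne_zero_iff_isUnit]
  constructor
  · intro h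
    obtain ⟨y, hy⟩ := h.exists_right_inv
    have h1 : ‖(x : K)‖ * ‖(y : K)‖ = 1 := by
      rw [← norm_mul, ← norm_one (α := K)]
      exact congrArg (fun z : Integers K => ‖(z : K)‖) hy
    have hx := mem_integers_iff.1 x.2
    have hy := mem_integers_iff.1 y.2
    nlinarith [norm_nonneg (x : K), norm_nonneg (y : K)]
  · intro h
    have hx : (x : K) ≠ 0 := by
      intro h0
      rw [h0, norm_zero] at h
      exact zero_ne_one h
    have hi : (x : K)⁻¹ ∈ Integers K := mem_integers_iff.2 (by rw [norm_inv, h, inv_one])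
    exact IsUnit.of_mul_eq_one ⟨_, hi⟩ (Subtype.ext (mul_inv_cancel₀ hx))

/-- Lift a monic polynomial to a monic one over the ring of integers. Its root in `K` is integral,
hence lies in this integrally closed ring, and its residue is a root. -/
lemma isAlgClosed_residue [IsAlgClosed K] : IsAlgClosed (Residue K) := by
  refine IsAlgClosed.of_exists_root _ fun p hp hirr => ?_
  have hl : p ∈ lifts (IsLocalRing.residue (Integers K)) := by
    rw [lifts_iff_coeff_lifts]
    exact fun n => IsLocalRing.residue_surjective _
  obtain ⟨q, rfl, hq, hmon⟩ := lifts_and_natDegree_eq_and_monic hl hp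
  have hdeg : (q.map (algebraMap (Integers K) K)).degree ≠ 0 := by
    rw [hmon.degree_map, degree_eq_natDegree hmon.ne_zero, hq]
    exact_mod_cast hirr.natDegree_pos.ne'
  obtain ⟨x, hx⟩ := IsAlgClosed.exists_root _ hdeg
  have hx' : eval₂ (algebraMap (Integers K) K) x q = 0 := by rw [← eval_map]; exact hx
  obtain ⟨y, rfl⟩ := IsIntegrallyClosed.isIntegral_iff.1 (⟨q, hmon, hx'⟩ : IsIntegral (Integers K) x)
  refine ⟨IsLocalRing.residue _ y, ?_⟩
  rw [eval_map, eval₂_at_apply]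
  rw [eval₂_at_apply] at hx'
  rw [(FaithfulSMul.algebraMap_injective (Integers K) K) (hx'.trans (map_zero _).symm), map_zero]

lemma one_lt_logBase : 1 < logBase K := by
  unfold logBase
  split_ifs with h
  · exact Real.one_lt_exp_iff.2 one_pos
  · have := (CharP.char_is_prime_or_zero (Residue K) (ringChar (Residue K))).resolve_right h
    exact_mod_cast this.one_lt

lemma ord_one : ord (1 : K) = 0 := by simp [ord]

lemma ord_mul {x y : K} (hx : x ≠ 0) (hy : y ≠ 0) : ord (x * y) = ord x + ord y := by
  rw [ord, norm_mul, Real.logb_mul (norm_ne_zero_iff.2 hx) (norm_ne_zero_iff.2 hy), ord, ord]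
  ring

lemma ord_pow (x : K) (n : ℕ) : ord (x ^ n) = n * ord x := by
  rw [ord, norm_pow, Real.logb_pow, ord]
  ring

lemma ord_inv (x : K) : ord x⁻¹ = -ord x := by
  rw [ord, norm_inv, Real.logb_inv, ord]

lemma ord_eq_zero_iff {x : K} (hx : x ≠ 0) : ord x = 0 ↔ ‖x‖ = 1 := by
  rw [ord, neg_eq_zero]
  constructor
  · intro h
    have hb := one_lt_logBase (K := K)
    rw [← Real.rpow_logb (one_pos.trans hb) hb.ne' (norm_pos_iff.2 hx), h, Real.rpow_zero]
  · intro h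
    rw [h, Real.logb_one]

lemma ord_nonpos {x : K} (hx : 1 ≤ ‖x‖) : ord x ≤ 0 := by
  rw [ord, neg_nonpos]
  exact Real.logb_nonneg one_lt_logBase hx

/-! ### Normalization, semistability and minimality of the resultant -/

/-- Dividing by a coefficient of largest absolute value normalizes the lift, and the resultant is
homogeneous of degree `2 * d` in the coefficients. -/
lemma ordRes_eq_sub {d : ℕ} {φ : RatFunc K} {a : Coeffs d K} (h : IsLift φ a)
    {m : Fin 2 × Fin (d + 1)} (hm0 : a m ≠ 0) (hm : ∀ ij, ‖a ij‖ ≤ ‖a m‖) :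
    ordRes φ = ord (resForm a) - 2 * d * ord (a m) := by
  have hle : ∀ ij, (a m)⁻¹ * a ij ∈ Integers K := fun ij => by
    rw [mem_integers_iff, norm_mul, norm_inv, inv_mul_le_one₀ (norm_pos_iff.2 hm0)]
    exact hm ij
  have hn : IsNormalizedLift φ (fun ij => (⟨_, hle ij⟩ : Integers K)) :=
    ⟨h.smul (inv_ne_zero hm0), m, by
      change ‖(a m)⁻¹ * a m‖ = 1
      rw [inv_mul_cancel₀ hm0, norm_one]⟩
  rw [ordRes_eq hn]
  change ord (resForm (fun ij => (a m)⁻¹ * a ij)) = _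
  rw [resForm_smul, ord_mul (pow_ne_zero _ (inv_ne_zero hm0)) h.1, ord_pow, ord_inv]
  push_cast
  ring

lemma norm_aeval_reduce {d : ℕ} {a : Coeffs d (Integers K)}
    {H : MvPolynomial (Fin 2 × Fin (d + 1)) ℤ} (h : MvPolynomial.aeval (reduce a) H ≠ 0) :
    ‖MvPolynomial.aeval (fun ij => (a ij : K)) H‖ = 1 := by
  have e : IsLocalRing.residue (Integers K) (MvPolynomial.aeval a H) =
      MvPolynomial.aeval (reduce a) H := map_aeval_int _ a H
  rw [← e, residue_ne_zero_iff] at h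
  have := map_aeval_int (Integers K).subtype a H
  simp only [ValuationSubring.subtype_apply] at this
  rw [← this]
  exact h

lemma norm_aeval_le {d D : ℕ} {H : MvPolynomial (Fin 2 × Fin (d + 1)) ℤ}
    (hH : H.IsHomogeneous D) {a : Coeffs d K} {c : K} (hc : c ≠ 0)
    (ha : ∀ ij, ‖a ij‖ ≤ ‖c‖) : ‖MvPolynomial.aeval a H‖ ≤ ‖c‖ ^ D := by
  have hle : ∀ ij, c⁻¹ * a ij ∈ Integers K := fun ij => by
    rw [mem_integers_iff, norm_mul, norm_inv, inv_mul_le_one₀ (norm_pos_iff.2 hc)]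
    exact ha ij
  have e : a = fun ij => c * (c⁻¹ * a ij) := funext fun ij => by rw [mul_inv_cancel_left₀ hc]
  rw [e, aeval_smul_of_isHomogeneous hH, norm_mul, norm_pow]
  refine mul_le_of_le_one_right (by positivity) (mem_integers_iff.1 ?_)
  have := map_aeval_int (Integers K).subtype (fun ij => ⟨_, hle ij⟩) H
  simp only [ValuationSubring.subtype_apply] at this
  rw [← this]
  exact Subtype.property _

/-- The minimum defining the minimal resultant is attained by a map with semistable
reduction. -/
lemma isMinimalResultant_of_isSemistable [IsAlgClosed K] {D : ℕ} (hD : 0 < D) {ψ : RatFunc K}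
    {a : Coeffs D (Integers K)} (ha : IsNormalizedLift ψ a) (hs : IsSemistable (reduce a)) :
    IsMinimalResultant ψ (ordRes ψ) := by
  constructor
  · refine ⟨1, ?_⟩
    have h := isLift_conj hD ha.1 (γ := 1) (g := 1) one_ne_zero (by simp)
    have e : conjCoeffs 1 (fun ij => (a ij : K)) = fun ij => (a ij : K) := by
      funext ⟨i, j⟩
      have hm : matPair (1 : Matrix (Fin 2) (Fin 2) K) = ![X, 1] := by
        rw [← linPair_X_one, linPair_one]
      rw [conjCoeffs_eq, conjPair, inv_one, Matrix.SpecialLinearGroup.coe_one, linPair_one, hm,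
        compPair_X_one (natDegree_coordPoly_le _)]
      exact coeff_coordPoly _ i j
    rw [e] at h
    change ordRes (conj ψ 1) = ordRes ψ
    rw [ordRes_eq ha, ordRes_eq (φ := conj ψ 1) (a := a) ⟨h, ha.2⟩]
  · rintro _ ⟨γ, rfl⟩
    change ordRes ψ ≤ ordRes (conj ψ γ)
    obtain ⟨c, g, hc, hg⟩ := exists_eq_smul_specialLinear γ
    have h := isLift_conj hD ha.1 hc hg
    obtain ⟨m, hm0, hm⟩ := exists_max_norm h.ne_zero
    rw [ordRes_eq_sub h hm0 hm, resForm_conjCoeffs, ordRes_eq ha]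
    obtain ⟨E, H, hE, hH, hinv, hne⟩ := hs
    have h1 := norm_aeval_le hH hm0 hm
    -- Invariance over `K` turns the bound into `1 ≤ ‖conjCoeffs g a m‖ ^ E`, so the subtracted term
    -- `2 D ord` is nonpositive.
    rw [hinv K g, norm_aeval_reduce hne] at h1
    have h2 := ord_nonpos ((one_le_pow_iff_of_nonneg (norm_nonneg _) hE.ne').1 h1)
    have h3 : (0 : ℝ) ≤ 2 * D := by positivity
    nlinarith

/-- Any two normalized lifts are proportional, and the ratio is integral because one lift has a
coefficient of absolute value 1. Their reductions then differ by a scalar, which homogeneous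
invariants pull out as a power. -/
lemma IsNormalizedLift.isSemistable_reduce {d : ℕ} {φ : RatFunc K}
    {a : Coeffs d (Integers K)} (ha : IsNormalizedLift φ a) (h : HasSemistableReduction φ) :
    IsSemistable (reduce a) := by
  obtain ⟨d', b, hb, D, H, hD, hH, hinv, hne⟩ := h
  obtain ⟨hd, c, hc, ha0, ha1⟩ := ha.1.eq_smul
  obtain ⟨hd', c', hc', hb0, hb1⟩ := hb.1.eq_smul
  obtain rfl : d = d' := hd.trans hd'.symm
  refine ⟨D, H, hD, hH, hinv, ?_⟩
  have hab : ∀ ij, (b ij : K) = c' / c * (a ij : K) := by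
    have key : ∀ i, coordPoly (fun ij => (b ij : K)) i =
        C (c' / c) * coordPoly (fun ij => (a ij : K)) i := by
      have hcc : C (c' / c) * C c = C c' := by rw [← C_mul, div_mul_cancel₀ _ hc]
      intro i
      fin_cases i
      · simp only [Fin.zero_eta, ha0, hb0, ← mul_assoc, hcc]
      · simp only [Fin.mk_one, ha1, hb1, ← mul_assoc, hcc]
    rintro ⟨i, j⟩
    have := congrArg (fun q => q.coeff (j : ℕ)) (key i)
    simpa only [coeff_C_mul, coeff_coordPoly] using this
  have ht : c' / c ∈ Integers K := by
    obtain ⟨s, hs⟩ := ha.2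
    have := mem_integers_iff.1 (b s).2
    rwa [hab, norm_mul, hs, mul_one, ← mem_integers_iff] at this
  have hred : reduce b = fun ij => IsLocalRing.residue (Integers K) ⟨_, ht⟩ * reduce a ij := by
    funext ij
    simp only [reduce]
    rw [← map_mul]
    exact congrArg _ (Subtype.ext (hab ij))
  rw [hred, aeval_smul_of_isHomogeneous hH] at hne
  exact right_ne_zero_of_mul hne

/-! ### The resultant iteration formula -/

section Iteration

variable {d : ℕ} {φ : RatFunc K} {a : Coeffs d (Integers K)}

lemma coe_iterCoeffs (a : Coeffs d (Integers K)) (n : ℕ) :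
    (fun ij => (iterCoeffs a n ij : K)) = iterCoeffs (fun ij => (a ij : K)) n :=
  funext fun ij => map_iterCoeffs (Integers K).subtype a n ij

lemma reduce_iterCoeffs (a : Coeffs d (Integers K)) (n : ℕ) :
    reduce (iterCoeffs a n) = iterCoeffs (reduce a) n :=
  funext fun ij => map_iterCoeffs (IsLocalRing.residue (Integers K)) a n ij

lemma ord_resForm_iterCoeffs [IsAlgClosed K] (hd : 2 ≤ d) {a : Coeffs d K}
    (ha : ∀ n, resForm (iterCoeffs a n) ≠ 0) (ha' : resForm a ≠ 0) (n : ℕ) :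
    ord (resForm (iterCoeffs a n)) = iterExponent d n * ord (resForm a) := by
  have h1 : (d : ℝ) ≠ 0 := by positivity
  have h2 : (d : ℝ) - 1 ≠ 0 := by
    have : (2 : ℝ) ≤ d := by exact_mod_cast hd
    linarith
  induction n with
  | zero => rw [resForm_iterCoeffs_zero, ord_one]; simp [iterExponent]
  | succ n ih =>
    rw [resForm_iterCoeffs_succ, ord_mul (pow_ne_zero _ ha') (pow_ne_zero _ (ha n)), ord_pow,
      ord_pow, ih]
    -- This recursion for the exponents `N_n` mirrors the composition formula for the resultants.
    have : iterExponent d (n + 1) = (d : ℝ) ^ n + d * d * iterExponent d n := by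
      unfold iterExponent
      field_simp
      ring
    rw [this]
    push_cast
    ring

/-- The resultant iteration formula holds for `φ ^ m` exactly when the `m`-th iterate of a
normalized lift of `φ` is normalized. -/
lemma ordRes_iter_eq_iff [IsAlgClosed K] (hd : 2 ≤ d) (ha : IsNormalizedLift φ a) (m : ℕ) :
    ordRes (iter φ m) = iterExponent d m * ordRes φ ↔
      IsNormalizedLift (iter φ m) (iterCoeffs a m) := by
  have hd0 : 0 < d := by omega
  have hlift := isLift_iter hd0 ha.1
  obtain ⟨s, hs0, hs⟩ := exists_max_norm (hlift m).ne_zero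
  have hres := ord_resForm_iterCoeffs hd (fun n => (hlift n).1) ha.1.1 m
  rw [ordRes_eq_sub (hlift m) hs0 hs, ordRes_eq ha, hres, sub_eq_self]
  have hpow : (2 * ((d ^ m : ℕ) : ℝ)) ≠ 0 := by positivity
  rw [mul_eq_zero, or_iff_right hpow, ord_eq_zero_iff hs0, IsNormalizedLift, coe_iterCoeffs,
    and_iff_right (hlift m)]
  simp only [← coe_iterCoeffs] at hs ⊢
  constructor
  · exact fun h => ⟨s, h⟩
  · rintro ⟨t, ht⟩
    -- The iterated coefficients are integral, so the maximal one has absolute value 1 as soon as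
    -- some coefficient does.
    exact le_antisymm (mem_integers_iff.1 (iterCoeffs a m s).2) (ht.ge.trans (hs t))

lemma isNormalizedLift_iterCoeffs_iff [IsAlgClosed K] (hd : 0 < d) (ha : IsNormalizedLift φ a)
    (m : ℕ) :
    IsNormalizedLift (iter φ m) (iterCoeffs a m) ↔ iterPair d (coordPoly (reduce a)) m ≠ 0 := by
  rw [← coordPoly_iterCoeffs, ← reduce_iterCoeffs, IsNormalizedLift, coe_iterCoeffs,
    and_iff_right (isLift_iter hd ha.1 m), ne_eq, funext_iff]
  have := coordPoly_eq_zero_iff (reduce (iterCoeffs a m))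
  simp only [Pi.zero_apply]
  rw [this, funext_iff, not_forall]
  exact exists_congr fun ij => (residue_ne_zero_iff _).symm

end Iteration

end NonArch

end RatDyn

end

theorem proposition5p2 {K : Type*} [NormedField K] [IsUltrametricDist K] [CompleteSpace K]
    [IsAlgClosed K] (φ : RatFunc K) (d : ℕ) (hd : 2 ≤ d) (hφ : RatDyn.degree φ = d)
    (n : ℕ) (hn : 1 ≤ n)
    (hss : RatDyn.HasSemistableReduction (RatDyn.iter φ n))
    (hR : RatDyn.ordRes (RatDyn.iter φ n) = RatDyn.iterExponent d n * RatDyn.ordRes φ) :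
    RatDyn.HasSemistableReduction φ ∧
    (∃ r : ℝ, RatDyn.IsMinimalResultant φ r ∧
      RatDyn.IsMinimalResultant (RatDyn.iter φ n) (RatDyn.iterExponent d n * r)) ∧
    (2 ≤ n → ∀ m : ℕ,
      RatDyn.ordRes (RatDyn.iter φ m) = RatDyn.iterExponent d m * RatDyn.ordRes φ) := by
  have hd0 : 0 < d := by omega
  subst hφ
  obtain ⟨a, ha⟩ := RatDyn.exists_isNormalizedLift φ
  have hn_norm := (RatDyn.ordRes_iter_eq_iff hd ha n).1 hR
  have hn_ss := hn_norm.isSemistable_reduce hss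
  have hss' : RatDyn.IsSemistable (RatDyn.reduce a) := by
    refine RatDyn.IsSemistable.of_iterCoeffs (n := n) hd0 hn ?_
    rwa [← RatDyn.reduce_iterCoeffs]
  refine ⟨⟨_, a, ha, hss'⟩, ⟨RatDyn.ordRes φ,
    RatDyn.isMinimalResultant_of_isSemistable hd0 ha hss', ?_⟩, fun h2 m => ?_⟩
  · rw [← hR]
    exact RatDyn.isMinimalResultant_of_isSemistable (pow_pos hd0 n) hn_norm hn_ss
  -- Supplies the instance needed to factor binary forms over the residue field in
  -- `iterPair_ne_zero`.
  · have := RatDyn.isAlgClosed_residue (K := K)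
    rw [RatDyn.ordRes_iter_eq_iff hd ha, RatDyn.isNormalizedLift_iterCoeffs_iff hd0 ha]
    rw [RatDyn.isNormalizedLift_iterCoeffs_iff hd0 ha] at hn_norm
    exact RatDyn.iterPair_ne_zero hd0 (RatDyn.natDegree_coordPoly_le _) h2 hn_norm m
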